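/- Let $S$ be a combinatorial closed disk, that is, a finite, simply connected simplicial $2$-complex that triangulates a surface with nonempty boundary (every edge lies in one or two triangles, all vertex links are connected, and some edge lies in only one triangle). Call a vertex interior if it lies on no boundary edge, a boundary edge being an edge contained in exactly one triangle. Let $\alpha_v\in\mathbb{R}$ be given for every vertex $v$ and $\eta_{vw}\in\mathbb{R}$ for every edge $vw$. Let $f$ be a label in the conformal structure $C_{\alpha,\eta}$, that is, a real function $v\mapsto f_v$ on the vertices such that $$\ell_{vw}^2=\alpha_v e^{2f_v}+\alpha_w e^{2f_w}+2\eta_{vw}e^{f_v+f_w}>0$$ for every edge $vw$, and such that the lengths $\ell_{vw}>0$ satisfy the strict triangle inequalities in every triangle of $S$. Suppose that for every interior vertex $v$ the curvature $$K_v=2\pi-\sum_{t\ni v}\theta(v<t)$$ is zero, where $t$ runs over the triangles of $S$ containing $v$ and $\theta(v<t)$ is the angle at $v$ in the Euclidean triangle $t$ with edge lengths $\ell$. (1) There are points $p(v)\in\mathbb{R}^2$, $v\in V(S)$, with $|p(v)-p(w)|=\ell_{vw}$ for every edge $vw$, placed without folding: whenever two different triangles $vwx$ and $vwy$ of $S$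 share the edge $vw$, the points $p(x)$ and $p(y)$ lie strictly on opposite sides of the line through $p(v)$ and $p(w)$. (2) The map $p$ is unique up to Euclidean isometry: if $p$ and $q$ are two such maps, then $q=g\circ p$ for an isometry $g$ of $\mathbb{R}^2$. (3) Write $\xi*\zeta=\xi^1\zeta^1+\xi^2\zeta^2+\xi^3\zeta^3-\xi^4\zeta^4$ for the Minkowski product on $\mathbb{R}^4$. For every map $p:V(S)\to\mathbb{R}^2$ with $|p(v)-p(w)|=\ell_{vw}$ for all edges $vw$ (in particular for the map of (1)), there are M-weighted points $\xi_v\in\mathbb{R}^4$, $v\in V(S)$, that is, points with $\xi_v^3<\xi_v^4$, such that $$\left(\frac{\xi_v^1}{\xi_v^4-\xi_v^3},\frac{\xi_v^2}{\xi_v^4-\xi_v^3}\right)=p(v)\quad\text{and}\quad \xi_v*\xi_v=\alpha_v\quad\text{for every vertex } v,$$ and $\xi_v*\xi_w=-\eta_{vw}$ for every edge $vw$. -/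

import Mathlib

noncomputable section

namespace DiscreteConformal

/-! ### Combinatorial closed disks -/

/-- The geometric realization of a finite abstract simplicial complex: the points of the standard
simplex on the vertex set (barycentric coordinates) whose support is a simplex of the complex. -/
def realization {V : Type*} [Fintype V] (S : AbstractSimplicialComplex V) : Set (V → ℝ) :=
  {x | x ∈ stdSimplex ℝ V ∧ Finset.univ.filter (fun v => x v ≠ 0) ∈ S.faces}

/-- The edges of the complex: its simplices with two vertices. -/
def edges {V : Type*} (S : AbstractSimplicialComplex V) : Set (Finset V) :=
  {e | e ∈ S.faces ∧ e.card = 2}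

/-- The triangles (2-dimensional faces) of the complex: its simplices with three vertices. -/
def triangles {V : Type*} (S : AbstractSimplicialComplex V) : Set (Finset V) :=
  {t | t ∈ S.faces ∧ t.card = 3}

/-- The triangles that contain the edge `e`. -/
def trianglesAt {V : Type*} (S : AbstractSimplicialComplex V) (e : Finset V) : Set (Finset V) :=
  {t | t ∈ triangles S ∧ e ⊆ t}

/-- The link of the vertex `v` as a graph (restricted to the neighbours of `v`, the other vertices
being isolated): `u` and `w` are adjacent when `v`, `u`, `w` are the vertices of a triangle. -/
def linkGraph {V : Type*} [DecidableEq V] (S : AbstractSimplicialComplex V) (v : V) :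
    SimpleGraph V where
  Adj u w := u ≠ w ∧ {v, u, w} ∈ triangles S
  symm := ⟨fun u w h => ⟨h.1.symm, by rw [Finset.pair_comm w u]; exact h.2⟩⟩
  loopless := ⟨fun _ h => h.1 rfl⟩

/-- A boundary edge: an edge that lies in exactly one triangle. -/
def IsBoundaryEdge {V : Type*} (S : AbstractSimplicialComplex V) (e : Finset V) : Prop :=
  e ∈ edges S ∧ (trianglesAt S e).ncard = 1

/-- A vertex is interior when it lies on no boundary edge. -/
def IsInteriorVertex {V : Type*} (S : AbstractSimplicialComplex V) (v : V) : Prop :=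
  ∀ e, IsBoundaryEdge S e → v ∉ e

/-- A combinatorial closed disk: a finite simplicial 2-complex that is a triangulated surface with
boundary (every edge lies in one or two triangles and every vertex link is connected, so that every
link is an arc or a circle), whose boundary is not empty, and which is simply connected. -/
structure IsCombinatorialClosedDisk {V : Type*} [Fintype V] [DecidableEq V]
    (S : AbstractSimplicialComplex V) : Prop where
  card_le_three : ∀ s ∈ S.faces, s.card ≤ 3
  edge_triangles : ∀ e ∈ edges S, (trianglesAt S e).ncard = 1 ∨ (trianglesAt S e).ncard = 2
  link_connected : ∀ v u w : V, {v, u} ∈ edges S → {v, w} ∈ edges S →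
    (linkGraph S v).Reachable u w
  boundary_nonempty : ∃ e, IsBoundaryEdge S e
  simplyConnected : SimplyConnectedSpace (realization S)

/-! ### Discrete conformal structures, labels, angles, curvature -/

/-- The squared length that the label `f` gives to the edge `e` in the conformal structure with
parameters `α` (on vertices) and `η` (on edges). For `e = {v, w}` with `v ≠ w` it is
`α v * exp (2 * f v) + α w * exp (2 * f w) + 2 * η {v, w} * exp (f v + f w)`. -/
def edgeSq {V : Type*} (α : V → ℝ) (η : Finset V → ℝ) (f : V → ℝ) (e : Finset V) : ℝ :=
  ∑ v ∈ e, α v * Real.exp (2 * f v) + 2 * η e * Real.exp (∑ v ∈ e, f v)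

theorem edgeSq_pair {V : Type*} [DecidableEq V] (α : V → ℝ) (η : Finset V → ℝ) (f : V → ℝ)
    {v w : V} (h : v ≠ w) :
    edgeSq α η f {v, w} =
      α v * Real.exp (2 * f v) + α w * Real.exp (2 * f w)
        + 2 * η {v, w} * Real.exp (f v + f w) := by
  simp [edgeSq, Finset.sum_pair h]

/-- The length of the edge `e`. -/
def edgeLength {V : Type*} (α : V → ℝ) (η : Finset V → ℝ) (f : V → ℝ) (e : Finset V) : ℝ :=
  Real.sqrt (edgeSq α η f e)

/-- `f` is a label in the conformal structure with parameters `α`, `η` on `S`, that is, it determines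
a piecewise Euclidean geometry: the squared lengths of the edges are positive and the edge lengths
satisfy the strict triangle inequalities in every triangle. -/
structure IsLabel {V : Type*} [DecidableEq V] (S : AbstractSimplicialComplex V)
    (α : V → ℝ) (η : Finset V → ℝ) (f : V → ℝ) : Prop where
  edgeSq_pos : ∀ e ∈ edges S, 0 < edgeSq α η f e
  triangle_lt : ∀ u v w : V, {u, v, w} ∈ triangles S →
    edgeLength α η f {u, w} < edgeLength α η f {u, v} + edgeLength α η f {v, w}

/-- The angle at the vertex `v` in the Euclidean triangle with vertex set `t` and edge lengths
`len`, by the law of cosines. The edge opposite to a vertex `u` of `t` is `t.erase u`. -/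
def angleIn {V : Type*} [DecidableEq V] (len : Finset V → ℝ) (v : V) (t : Finset V) : ℝ :=
  Real.arccos
    ((∑ u ∈ t.erase v, len (t.erase u) ^ 2 - len (t.erase v) ^ 2)
      / (2 * ∏ u ∈ t.erase v, len (t.erase u)))

theorem angleIn_triple {V : Type*} [DecidableEq V] (len : Finset V → ℝ) {v u w : V}
    (hvu : v ≠ u) (hvw : v ≠ w) (huw : u ≠ w) :
    angleIn len v {v, u, w} =
      Real.arccos ((len {v, u} ^ 2 + len {v, w} ^ 2 - len {u, w} ^ 2)
        / (2 * (len {v, u} * len {v, w}))) := by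
  have h1 : ({v, u, w} : Finset V).erase v = {u, w} := by
    ext x; simp; grind
  have h2 : ({v, u, w} : Finset V).erase u = {v, w} := by
    ext x; simp; grind
  have h3 : ({v, u, w} : Finset V).erase w = {v, u} := by
    ext x; simp; grind
  unfold angleIn
  rw [h1, Finset.sum_pair huw, Finset.prod_pair huw, h2, h3,
    add_comm (len {v, w} ^ 2), mul_comm (len {v, w})]

open scoped Classical in
/-- The curvature at `v`: `2 * π` minus the sum of the angles at `v` in the triangles at `v`. -/
def curvature {V : Type*} [Fintype V] [DecidableEq V] (S : AbstractSimplicialComplex V)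
    (α : V → ℝ) (η : Finset V → ℝ) (f : V → ℝ) (v : V) : ℝ :=
  2 * Real.pi -
    ∑ t ∈ Finset.univ.filter (fun t : Finset V => t ∈ triangles S ∧ v ∈ t),
      angleIn (edgeLength α η f) v t

/-! ### Placing the disk in the plane -/

/-- The Euclidean plane. -/
abbrev Plane : Type := EuclideanSpace ℝ (Fin 2)

/-- The points `p` realize the lengths of all edges of `S`. -/
def RealizesLengths {V : Type*} [DecidableEq V] (S : AbstractSimplicialComplex V)
    (len : Finset V → ℝ) (p : V → Plane) : Prop :=
  ∀ v w : V, {v, w} ∈ edges S → len {v, w} = dist (p v) (p w)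

/-- The points `p` lay the triangles of `S` out in the plane without folding: the third vertices of
two different triangles with a common edge lie strictly on opposite sides of the line through that
edge. -/
def IsUnfolded {V : Type*} [DecidableEq V] (S : AbstractSimplicialComplex V)
    (p : V → Plane) : Prop :=
  ∀ v w x y : V, x ≠ y → {v, w, x} ∈ triangles S → {v, w, y} ∈ triangles S →
    (affineSpan ℝ {p v, p w}).SOppSide (p x) (p y)

/-! ### M-weighted points -/

/-- The Minkowski product on `ℝ⁴`. -/
def minkowski (ξ ζ : Fin 4 → ℝ) : ℝ :=
  ξ 0 * ζ 0 + ξ 1 * ζ 1 + ξ 2 * ζ 2 - ξ 3 * ζ 3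

/-- The set of M-weighted points: the `ξ` in `ℝ⁴` whose third coordinate is smaller than the
fourth. -/
def MWeighted : Set (Fin 4 → ℝ) :=
  {ξ | ξ 2 < ξ 3}

/-- The point of the plane that underlies an M-weighted point. -/
def mPoint (ξ : Fin 4 → ℝ) : Plane :=
  !₂[ξ 0 / (ξ 3 - ξ 2), ξ 1 / (ξ 3 - ξ 2)]

end DiscreteConformal

end

noncomputable section

namespace DiscreteConformal
open Set Topology

/-! ### The realization of a complex and its open stars -/

section Topological

/-! Developing a flat disk: each vertex star is placed in the plane, and the stars are glued by
simple connectivity.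

The link of a vertex is a connected graph of degree at most two, hence an arc or a circle. Adding up
the angles along it gives its vertices polar angles. On a circle the last edge must also close up
modulo `2 * π`, which is exactly zero curvature; on an arc nothing is required (`exists_angles`,
`exists_isStarPlacement`).

The placements of two stars differ, on the triangles at a common edge, by one isometry
(`exists_isometryEquiv_of_unfoldedAt`): a triangle is rigid, and unfoldedness fixes the side of the
second triangle. Since an isometry is determined by its values on a nondegenerate triangle, these
transition isometries form a cocycle. A cocycle in a group defines a covering of the realization,
whose global section over a simply connected base makes it a coboundary (`exists_coboundary`).
Correcting each star by its term of the coboundary gives the global placement. Uniqueness needs only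
connectedness: the isometries found on the stars agree on common triangles, so they are constant
along edges (`eq_of_eq_on_edges`).

The M-weighted points come from an explicit formula. It uses the realized lengths alone, not the
topology of the disk nor its curvature (`exists_mWeighted_points`). -/

theorem face_of_subset {V : Type*} {S : AbstractSimplicialComplex V} {s t : Finset V}
    (hs : s ∈ S.faces) (h : t ⊆ s) (ht : t.Nonempty) :
    t ∈ S.faces :=
  (S.isRelLowerSet_faces hs).2 h ht

variable {V : Type*} [Fintype V] {S : AbstractSimplicialComplex V}

theorem mem_realization_of_support_subset {x : V → ℝ} {s : Finset V} (hx : x ∈ stdSimplex ℝ V)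
    (hs : s ∈ S.faces) (h : ∀ v, x v ≠ 0 → v ∈ s) : x ∈ realization S := by
  refine ⟨hx, face_of_subset hs (fun v hv => h v (by simpa using hv)) ?_⟩
  by_contra hne
  have h0 : ∀ v, x v = 0 := by
    intro v
    by_contra hv
    exact hne ⟨v, by simpa using hv⟩
  have := hx.2
  simp [h0] at this

/-- The support of `y` is the larger one, so the whole segment stays in the simplex that carries
`y`. Both star-shapedness arguments below rest on this. -/
theorem segment_mem_realization {x y : V → ℝ} (hx : x ∈ stdSimplex ℝ V) (hy : y ∈ realization S)
    (h : ∀ v, x v ≠ 0 → y v ≠ 0) {a b : ℝ} (ha : 0 ≤ a) (hb : 0 ≤ b) (hab : a + b = 1) :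
    a • x + b • y ∈ realization S := by
  refine mem_realization_of_support_subset
    (convex_stdSimplex ℝ V hx hy.1 ha hb hab) hy.2 fun v hv => ?_
  have : y v ≠ 0 := by
    intro h0
    have hx0 : x v = 0 := by
      by_contra hne
      exact h v hne h0
    exact hv (by simp [h0, hx0])
  simpa using this

/-- Needed to lift maps to coverings. A ball around `x` whose radius is at most every nonzero
coordinate of `x` contains only points whose support includes that of `x`; such a ball is
star-shaped about `x`. -/
instance realization_locallyPathConnected :
    LocallyPathConnectedSpace (realization S) := by
  refine LocallyPathConnectedSpace.of_bases
    (p := fun (x : realization S) (r : ℝ) => 0 < r ∧ ∀ v, x.1 v ≠ 0 → r ≤ x.1 v)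
    (s := fun x r => Metric.ball x r) (fun x => Metric.nhds_basis_ball.restrict ?_) ?_
  · intro r hr
    obtain ⟨ε, hε, hε'⟩ : ∃ ε : ℝ, 0 < ε ∧ ∀ v, x.1 v ≠ 0 → ε ≤ x.1 v := by
      have : ∀ᶠ ε : ℝ in 𝓝[>] 0, ∀ v, x.1 v ≠ 0 → ε ≤ x.1 v := by
        refine Filter.eventually_all.2 fun v => ?_
        by_cases h : x.1 v = 0
        · simp [h]
        · have hpos : 0 < x.1 v := lt_of_le_of_ne (x.2.1.1 v) (Ne.symm h)
          filter_upwards [Ioo_mem_nhdsGT hpos] with ε hε _ using hε.2.le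
      obtain ⟨ε, h1, h2⟩ := (this.and self_mem_nhdsWithin).exists
      exact ⟨ε, h2, h1⟩
    exact ⟨min r ε, lt_min hr hε, fun v hv => (min_le_right _ _).trans (hε' v hv),
      Metric.ball_subset_ball (min_le_left _ _)⟩
  · rintro x r ⟨hr, hr'⟩
    rw [IsInducing.subtypeVal.isPathConnected_iff]
    refine StarConvex.isPathConnected (a := x.1) ?_ ⟨x, Metric.mem_ball_self hr, rfl⟩
    rintro _ ⟨y, hy, rfl⟩ a b ha hb hab
    have hsupp : ∀ v, x.1 v ≠ 0 → y.1 v ≠ 0 := by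
      intro v hv h0
      have h1 := (dist_le_pi_dist y.1 x.1 v).trans_lt hy
      rw [h0, Real.dist_eq, zero_sub, abs_neg] at h1
      exact (h1.trans_le (hr' v hv)).not_ge (le_abs_self _)
    refine ⟨⟨_, segment_mem_realization x.2.1 y.2 hsupp ha hb hab⟩, ?_, rfl⟩
    have : a • x.1 + b • y.1 ∈ Metric.ball x.1 r :=
      convex_ball x.1 r (Metric.mem_ball_self hr) hy ha hb hab
    exact this

/-- The open star of a vertex. -/
def openStar (S : AbstractSimplicialComplex V) (v : V) : Set (realization S) := {x | x.1 v ≠ 0}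

theorem isOpen_openStar (v : V) : IsOpen (openStar S v) :=
  isOpen_ne_fun ((continuous_apply v).comp continuous_subtype_val) continuous_const

theorem exists_mem_openStar (x : realization S) : ∃ v, x ∈ openStar S v := by
  by_contra! h
  have h0 : ∀ v, x.1 v = 0 := fun v => by simpa [openStar] using h v
  have := x.2.1.2
  simp [h0] at this

theorem exists_face_of_mem_openStar (x : realization S) :
    ∃ s ∈ S.faces, ∀ v, x ∈ openStar S v → v ∈ s :=
  ⟨_, x.2.2, fun v hv => by simpa [openStar] using hv⟩

variable [DecidableEq V]

/-- The case `u = v` is allowed and gives nonemptiness of a single star. -/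
theorem exists_mem_openStar_inter {u v : V} (h : {u, v} ∈ S.faces) :
    ∃ x : realization S, x ∈ openStar S u ∧ x ∈ openStar S v := by
  have hc : (1 / 2 : ℝ) • Pi.single u (1 : ℝ) + (1 / 2 : ℝ) • Pi.single v 1 ∈ stdSimplex ℝ V :=
    convex_stdSimplex ℝ V (single_mem_stdSimplex ℝ u) (single_mem_stdSimplex ℝ v)
      (by norm_num) (by norm_num) (by norm_num)
  refine ⟨⟨_, mem_realization_of_support_subset hc h fun w hw => ?_⟩, ?_, ?_⟩
  · by_contra hne
    simp only [Finset.mem_insert, Finset.mem_singleton, not_or] at hne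
    exact hw (by simp [hne.1, hne.2])
  · by_cases huv : u = v <;> simp [openStar, huv]
  · by_cases huv : v = u <;> simp [openStar, huv]

/-- The open star is star-shaped about the vertex itself. -/
theorem isPreconnected_openStar (v : V) : IsPreconnected (openStar S v) := by
  rw [← IsInducing.subtypeVal.isPreconnected_image]
  have hv : (Pi.single v 1 : V → ℝ) ∈ realization S :=
    mem_realization_of_support_subset (single_mem_stdSimplex ℝ v) (S.singleton_mem v) fun w hw => by
      by_contra hne
      exact hw (Pi.single_eq_of_ne (by simpa using hne) _)
  suffices h : StarConvex ℝ (Pi.single v 1 : V → ℝ) (Subtype.val '' openStar S v) from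
    (h.isPathConnected ⟨⟨_, hv⟩, by simp [openStar], rfl⟩).isConnected.isPreconnected
  rintro _ ⟨y, hy, rfl⟩ a b ha hb hab
  refine ⟨⟨_, segment_mem_realization hv.1 y.2 (fun w hw => ?_) ha hb hab⟩, ?_, rfl⟩
  · have : w = v := by
      by_contra hne
      exact hw (Pi.single_eq_of_ne hne _)
    rwa [this]
  · have h1 : 0 < y.1 v := lt_of_le_of_ne (y.2.1.1 v) (Ne.symm hy)
    have : 0 < a * 1 + b * y.1 v := by
      rcases ha.eq_or_lt with rfl | ha
      · have : b = 1 := by linarith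
        simpa [this] using h1
      · positivity
    simpa [openStar] using this.ne'

/-- A function on the vertices of a connected complex that is constant on edges is constant. -/
theorem eq_of_eq_on_edges [PreconnectedSpace (realization S)] {X : Type*} (c : V → X)
    (hc : ∀ u v, {u, v} ∈ edges S → c u = c v) (u v : V) : c u = c v := by
  have hc' : ∀ u v, {u, v} ∈ S.faces → c u = c v := by
    intro u v h
    by_cases huv : u = v
    · rw [huv]
    · exact hc u v ⟨h, Finset.card_pair huv⟩
  have hpair : ∀ {x : realization S} {u v}, x ∈ openStar S u → x ∈ openStar S v → c u = c v := by
    intro x u v hu hv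
    obtain ⟨s, hs, hs'⟩ := exists_face_of_mem_openStar x
    exact hc' u v (face_of_subset hs (by simp [Finset.insert_subset_iff, hs' u hu, hs' v hv])
      (by simp))
  -- Two vertices whose open stars meet span a face and so have equal values. Hence the stars
  -- belonging to the value `c u` and those belonging to other values are disjoint open sets
  -- covering the space.
  have hclopen : IsClopen (⋃ w ∈ {w | c w = c u}, openStar S w) := by
    refine ⟨⟨?_⟩, isOpen_biUnion fun w _ => isOpen_openStar w⟩
    have : (⋃ w ∈ {w | c w = c u}, openStar S w)ᶜ = ⋃ w ∈ {w | c w ≠ c u}, openStar S w := by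
      ext x
      simp only [mem_compl_iff, mem_iUnion, mem_ofPred_eq, exists_prop, not_exists, not_and]
      constructor
      · intro h
        obtain ⟨w, hw⟩ := exists_mem_openStar x
        exact ⟨w, fun h' => h w h' hw, hw⟩
      · rintro ⟨w, hw, hxw⟩ w' hw' hxw'
        exact hw ((hpair hxw hxw').trans hw')
    rw [this]
    exact isOpen_biUnion fun w _ => isOpen_openStar w
  obtain ⟨x, hx, -⟩ := exists_mem_openStar_inter (S := S) (u := u) (v := u)
    (by simpa using S.singleton_mem u)
  obtain ⟨y, hy, -⟩ := exists_mem_openStar_inter (S := S) (u := v) (v := v)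
    (by simpa using S.singleton_mem v)
  have huniv := hclopen.eq_univ ⟨x, mem_biUnion rfl hx⟩
  have hy' : y ∈ ⋃ w ∈ {w | c w = c u}, openStar S w := huniv ▸ mem_univ y
  simp only [mem_iUnion, mem_ofPred_eq, exists_prop] at hy'
  obtain ⟨w, hw, hyw⟩ := hy'
  exact hw.symm.trans (hpair hyw hy)

/-- A cocycle with values in a discrete group defines a bundle over the realization that is
trivial over the open stars. -/
def cocycleBundle {G : Type*} [Group G] [TopologicalSpace G] [DiscreteTopology G] (g : V → V → G)
    (hg : ∀ s ∈ S.faces, ∀ u ∈ s, ∀ v ∈ s, ∀ w ∈ s, g u v * g v w = g u w) :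
    FiberBundleCore V (realization S) G where
  baseSet := openStar S
  isOpen_baseSet := isOpen_openStar
  indexAt x := (exists_mem_openStar x).choose
  mem_baseSet_at x := (exists_mem_openStar x).choose_spec
  coordChange i j _ γ := g j i * γ
  coordChange_self i x hx γ := by
    obtain ⟨s, hs, hs'⟩ := exists_face_of_mem_openStar x
    have := hg s hs i (hs' i hx) i (hs' i hx) i (hs' i hx)
    -- The cocycle identity on `i, i, i` makes `g i i` idempotent, so it is the identity.
    rw [mul_eq_left.1 this, one_mul]
  continuousOn_coordChange i j :=
    ((continuous_of_discreteTopology (f := fun γ : G => g j i * γ)).comp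
      continuous_snd).continuousOn
  coordChange_comp i j k x hx γ := by
    obtain ⟨s, hs, hs'⟩ := exists_face_of_mem_openStar x
    rw [← mul_assoc, hg s hs k (hs' k hx.2) j (hs' j hx.1.2) i (hs' i hx.1.1)]

/-- Over a simply connected complex every cocycle with values in a group is a coboundary. -/
theorem exists_coboundary [SimplyConnectedSpace (realization S)] {G : Type*} [Group G]
    (g : V → V → G)
    (hg : ∀ s ∈ S.faces, ∀ u ∈ s, ∀ v ∈ s, ∀ w ∈ s, g u v * g v w = g u w) :
    ∃ h : V → G, ∀ u v, {u, v} ∈ S.faces → h u = g u v * h v := by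
  let _ : TopologicalSpace G := ⊥
  have : DiscreteTopology G := ⟨rfl⟩
  let Z := cocycleBundle g hg
  have cov : IsCoveringMap (Bundle.TotalSpace.proj : Z.TotalSpace → realization S) :=
    FiberBundle.isCoveringMap (F := G) (E := Z.Fiber)
  obtain ⟨x₀⟩ : Nonempty (realization S) := inferInstance
  -- A lift of the identity map is a global section. Its coordinates `c v` in the chart over the
  -- star of `v` are continuous into a discrete group, so they are constant on that connected star.
  -- These constants are the coboundary.
  obtain ⟨F, ⟨-, hF⟩, -⟩ := cov.existsUnique_continuousMap_lifts (ContinuousMap.id _) x₀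
    (⟨x₀, (1 : G)⟩ : Z.TotalSpace) rfl
  have hF' : ∀ x, (F x).proj = x := fun x => congrFun hF x
  let c : V → realization S → G := fun v x => (Z.localTriv v (F x)).2
  have hcc : ∀ u v x, x ∈ openStar S u → x ∈ openStar S v → c u x = g u v * c v x := by
    intro u v x hu hv
    have h1 := Z.coordChange_comp (Z.indexAt x) v u x
      ⟨⟨Z.mem_baseSet_at x, hv⟩, hu⟩ (F x).2
    change Z.coordChange (Z.indexAt (F x).proj) u (F x).proj (F x).2 =
      Z.coordChange v u x (Z.coordChange (Z.indexAt (F x).proj) v (F x).proj (F x).2)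
    rw [hF' x]
    exact h1.symm
  have hcont : ∀ v, ContinuousOn (c v) (openStar S v) := by
    intro v
    refine continuous_snd.comp_continuousOn
      ((Z.localTriv v).continuousOn_toFun.comp F.continuous.continuousOn fun x hx => ?_)
    change (F x).proj ∈ openStar S v
    rwa [hF' x]
  have hconst : ∀ v x y, x ∈ openStar S v → y ∈ openStar S v → c v x = c v y :=
    fun v x y hx hy => (isPreconnected_openStar v).constant (hcont v) hx hy
  have hne : ∀ v, ∃ x, x ∈ openStar S v := fun v => by
    obtain ⟨x, hx, -⟩ := exists_mem_openStar_inter (S := S) (u := v) (v := v)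
      (by simpa using S.singleton_mem v)
    exact ⟨x, hx⟩
  choose b hb using hne
  refine ⟨fun v => c v (b v), fun u v huv => ?_⟩
  obtain ⟨x, hu, hv⟩ := exists_mem_openStar_inter huv
  change c u (b u) = g u v * c v (b v)
  rw [hconst u _ x (hb u) hu, hconst v _ x (hb v) hv]
  exact hcc u v x hu hv

end Topological

/-! ### Triangles in the plane -/

theorem plane_ext {x y : Plane} (h0 : x 0 = y 0) (h1 : x 1 = y 1) : x = y := by
  ext i
  fin_cases i
  exacts [h0, h1]

theorem dist_sq_plane (x y : Plane) : dist x y ^ 2 = (x 0 - y 0) ^ 2 + (x 1 - y 1) ^ 2 := by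
  rw [EuclideanSpace.dist_eq, Real.sq_sqrt (by positivity)]
  simp [Real.dist_eq, sq_abs]

/-- Twice the signed area of the triangle with vertices `a`, `b`, `c`. -/
def cross (a b c : Plane) : ℝ := (b 0 - a 0) * (c 1 - a 1) - (b 1 - a 1) * (c 0 - a 0)

/-- Heron's formula. -/
theorem four_mul_cross_sq (a b c : Plane) :
    4 * cross a b c ^ 2 = 4 * dist a b ^ 2 * dist a c ^ 2
      - (dist a b ^ 2 + dist a c ^ 2 - dist b c ^ 2) ^ 2 := by
  simp only [dist_sq_plane, cross]
  ring

/-- Heron's expression factors into the perimeter and the three triangle excesses, all positive. -/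
theorem cross_ne_zero_of_triangle_lt {a b c : Plane} (h1 : dist a b < dist a c + dist b c)
    (h2 : dist a c < dist a b + dist b c) (h3 : dist b c < dist a b + dist a c) :
    cross a b c ≠ 0 := by
  have h := four_mul_cross_sq a b c
  have hpos : 0 < (dist a b + dist a c + dist b c) * (dist a b + dist a c - dist b c)
      * ((dist a c + dist b c - dist a b) * (dist a b + dist b c - dist a c)) := by
    have : 0 < dist a b + dist a c + dist b c := by
      linarith [dist_nonneg (x := a) (y := b), dist_nonneg (x := a) (y := c)]
    refine mul_pos (mul_pos this (by linarith)) (mul_pos (by linarith) (by linarith))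
  intro h0
  rw [h0] at h
  nlinarith

theorem cross_ne_zero_of_dist_eq {a b c a' b' c' : Plane} (h : cross a b c ≠ 0)
    (hab : dist a b = dist a' b') (hac : dist a c = dist a' c') (hbc : dist b c = dist b' c') :
    cross a' b' c' ≠ 0 := by
  intro h0
  have h1 := four_mul_cross_sq a b c
  rw [hab, hac, hbc, ← four_mul_cross_sq, h0] at h1
  apply h
  have : cross a b c ^ 2 = 0 := by linarith
  exact pow_eq_zero_iff two_ne_zero |>.1 this

/-- A point of the plane is determined by its distances to three points not on a line. -/
theorem eq_of_dist_eq {a b c x y : Plane} (h : cross a b c ≠ 0) (ha : dist x a = dist y a)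
    (hb : dist x b = dist y b) (hc : dist x c = dist y c) : x = y := by
  have ha' := congrArg (· ^ 2) ha
  have hb' := congrArg (· ^ 2) hb
  have hc' := congrArg (· ^ 2) hc
  simp only [dist_sq_plane] at ha' hb' hc'
  have e1 : (b 0 - a 0) * (x 0 - y 0) + (b 1 - a 1) * (x 1 - y 1) = 0 := by linarith
  have e2 : (c 0 - a 0) * (x 0 - y 0) + (c 1 - a 1) * (x 1 - y 1) = 0 := by linarith
  refine plane_ext ?_ ?_
  · have : cross a b c * (x 0 - y 0) = 0 := by
      unfold cross
      linear_combination (c 1 - a 1) * e1 - (b 1 - a 1) * e2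
    linarith [(mul_eq_zero.1 this).resolve_left h]
  · have : cross a b c * (x 1 - y 1) = 0 := by
      unfold cross
      linear_combination (b 0 - a 0) * e2 - (c 0 - a 0) * e1
    linarith [(mul_eq_zero.1 this).resolve_left h]

theorem isometryEquiv_eq {a b c : Plane} (h : cross a b c ≠ 0) {g g' : Plane ≃ᵢ Plane}
    (ha : g a = g' a) (hb : g b = g' b) (hc : g c = g' c) : g = g' := by
  ext1 x
  have h' := cross_ne_zero_of_dist_eq h (g.dist_eq a b).symm (g.dist_eq a c).symm
    (g.dist_eq b c).symm
  refine eq_of_dist_eq h' ?_ ?_ ?_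
  · rw [g.dist_eq, ha, g'.dist_eq]
  · rw [g.dist_eq, hb, g'.dist_eq]
  · rw [g.dist_eq, hc, g'.dist_eq]

/-- The affine map between the two triangles, with coordinates from Cramer's rule. It preserves
distances because the inner products of the edge vectors are determined by the three side lengths
(polarization). -/
theorem exists_isometry {a b c a' b' c' : Plane} (h : cross a b c ≠ 0)
    (hab : dist a b = dist a' b') (hac : dist a c = dist a' c') (hbc : dist b c = dist b' c') :
    ∃ g : Plane → Plane, Isometry g ∧ g a = a' ∧ g b = b' ∧ g c = c' := by
  refine ⟨fun x => a' + (cross a x c / cross a b c) • (b' - a')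
    + (cross a b x / cross a b c) • (c' - a'), Isometry.of_dist_eq fun x y => ?_, ?_, ?_, ?_⟩
  · have hab' := congrArg (· ^ 2) hab
    have hac' := congrArg (· ^ 2) hac
    have hbc' := congrArg (· ^ 2) hbc
    simp only [dist_sq_plane] at hab' hac' hbc'
    rw [← sq_eq_sq₀ dist_nonneg dist_nonneg]
    obtain ⟨s, hs⟩ : ∃ s, s = (cross a x c - cross a y c) / cross a b c := ⟨_, rfl⟩
    obtain ⟨t, ht⟩ : ∃ t, t = (cross a b x - cross a b y) / cross a b c := ⟨_, rfl⟩
    have hx0 : x 0 - y 0 = s * (b 0 - a 0) + t * (c 0 - a 0) := by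
      rw [hs, ht]
      field_simp
      unfold cross
      ring
    have hx1 : x 1 - y 1 = s * (b 1 - a 1) + t * (c 1 - a 1) := by
      rw [hs, ht]
      field_simp
      unfold cross
      ring
    have key : ∀ i, (a' + (cross a x c / cross a b c) • (b' - a')
        + (cross a b x / cross a b c) • (c' - a')) i - (a' + (cross a y c / cross a b c) • (b' - a')
        + (cross a b y / cross a b c) • (c' - a')) i = s * (b' i - a' i) + t * (c' i - a' i) := by
      intro i
      rw [hs, ht]
      simp only [PiLp.add_apply, PiLp.smul_apply, PiLp.sub_apply, smul_eq_mul]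
      ring
    rw [dist_sq_plane, dist_sq_plane, key, key, hx0, hx1]
    linear_combination (-s ^ 2 - s * t) * hab' + (-t ^ 2 - s * t) * hac' + s * t * hbc'
  · have h1 : cross a a c = 0 := by unfold cross; ring
    have h2 : cross a b a = 0 := by unfold cross; ring
    simp [h1, h2]
  · have h2 : cross a b b = 0 := by unfold cross; ring
    simp [h2, h]
  · have h2 : cross a c c = 0 := by unfold cross; ring
    simp [h2, h]

theorem exists_isometryEquiv {a b c a' b' c' : Plane} (h : cross a b c ≠ 0)
    (hab : dist a b = dist a' b') (hac : dist a c = dist a' c') (hbc : dist b c = dist b' c') :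
    ∃ g : Plane ≃ᵢ Plane, g a = a' ∧ g b = b' ∧ g c = c' := by
  have h' := cross_ne_zero_of_dist_eq h hab hac hbc
  obtain ⟨g, hg, ga, gb, gc⟩ := exists_isometry h hab hac hbc
  obtain ⟨k, hk, ka, kb, kc⟩ := exists_isometry h' hab.symm hac.symm hbc.symm
  refine ⟨IsometryEquiv.mk' g k (fun x => ?_) hg, ga, gb, gc⟩
  -- The composite `g ∘ k` is an isometry fixing `a'`, `b'`, `c'`, so `g (k x)` and `x` have the
  -- same distances to these points.
  refine eq_of_dist_eq h' ?_ ?_ ?_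
  · conv_lhs => rw [← ga, hg.dist_eq, ← ka, hk.dist_eq]
  · conv_lhs => rw [← gb, hg.dist_eq, ← kb, hk.dist_eq]
  · conv_lhs => rw [← gc, hg.dist_eq, ← kc, hk.dist_eq]

theorem mem_line_iff {a b x : Plane} (h : a ≠ b) :
    x ∈ affineSpan ℝ {a, b} ↔ cross a b x = 0 := by
  rw [mem_affineSpan_pair_iff_exists_lineMap_eq]
  constructor
  · rintro ⟨r, rfl⟩
    simp only [cross, AffineMap.lineMap_apply, vsub_eq_sub, vadd_eq_add, PiLp.add_apply,
      PiLp.smul_apply, PiLp.sub_apply, smul_eq_mul]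
    ring
  · intro hx
    unfold cross at hx
    have hd : (b 0 - a 0) ^ 2 + (b 1 - a 1) ^ 2 ≠ 0 := by
      rw [← dist_sq_plane]
      exact pow_ne_zero _ (dist_ne_zero.2 h.symm)
    -- The parameter of the orthogonal projection of `x` to the line.
    refine ⟨((x 0 - a 0) * (b 0 - a 0) + (x 1 - a 1) * (b 1 - a 1))
      / ((b 0 - a 0) ^ 2 + (b 1 - a 1) ^ 2), plane_ext ?_ ?_⟩ <;>
    · simp only [AffineMap.lineMap_apply, vsub_eq_sub, vadd_eq_add, PiLp.add_apply,
        PiLp.smul_apply, PiLp.sub_apply, smul_eq_mul]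
      field_simp
      first
        | linear_combination (b 1 - a 1) * hx
        | linear_combination -(b 0 - a 0) * hx

theorem sOppSide_line_iff {a b x y : Plane} (h : a ≠ b) :
    (affineSpan ℝ {a, b}).SOppSide x y ↔ cross a b x * cross a b y < 0 := by
  constructor
  · rintro ⟨⟨p, hp, q, hq, hr⟩, hx, hy⟩
    rw [mem_line_iff h] at hp hq hx hy
    rcases hr with hr | hr | ⟨r, s, hr, hs, hrs⟩
    · exact absurd hp (by rwa [vsub_eq_zero_iff_eq.1 hr] at hx)
    · exact absurd hq (by rwa [← vsub_eq_zero_iff_eq.1 hr] at hy)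
    · have h0 : r * (x 0 - p 0) = s * (q 0 - y 0) := by
        simpa using congrArg (fun z : Plane => z 0) hrs
      have h1 : r * (x 1 - p 1) = s * (q 1 - y 1) := by
        simpa using congrArg (fun z : Plane => z 1) hrs
      have e : r * cross a b x = - s * cross a b y := by
        unfold cross at *
        linear_combination (b 0 - a 0) * h1 - (b 1 - a 1) * h0 + r * hp + s * hq
      have hx2 : 0 < r * cross a b x ^ 2 := by positivity
      have e' : r * cross a b x ^ 2 = -(s * (cross a b x * cross a b y)) := by
        linear_combination cross a b x * e
      by_contra! hneg
      linarith [mul_nonneg hs.le hneg]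
  · intro hneg
    have hx : cross a b x ≠ 0 := fun h0 => by simp [h0] at hneg
    have hy : cross a b y ≠ 0 := fun h0 => by simp [h0] at hneg
    have hd : cross a b y - cross a b x ≠ 0 := fun h0 => by
      rw [sub_eq_zero.1 h0] at hneg
      nlinarith
    -- The zero of the affine function `cross a b` on the segment from `y` to `x`, that is, where
    -- the segment meets the line.
    obtain ⟨t, ht⟩ : ∃ t, t = cross a b y / (cross a b y - cross a b x) := ⟨_, rfl⟩
    have hz : t • x + (1 - t) • y ∈ affineSpan ℝ {a, b} := by
      rw [mem_line_iff h]
      have e : cross a b (t • x + (1 - t) • y) = t * cross a b x + (1 - t) * cross a b y := by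
        simp only [cross, PiLp.add_apply, PiLp.smul_apply, smul_eq_mul]
        ring
      rw [e, ht]
      field_simp
      ring
    refine ⟨⟨_, hz, _, hz, ?_⟩, fun h0 => hx ((mem_line_iff h).1 h0),
      fun h0 => hy ((mem_line_iff h).1 h0)⟩
    have ht0 : 0 ≤ t := by
      rw [ht, div_nonneg_iff]
      rcases lt_or_gt_of_ne hy with hy | hy
      · right; constructor <;> nlinarith
      · left; constructor <;> nlinarith
    have ht1 : 0 ≤ 1 - t := by
      have : 1 - t = - cross a b x / (cross a b y - cross a b x) := by
        rw [ht]; field_simp; ring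
      rw [this, div_nonneg_iff]
      rcases lt_or_gt_of_ne hx with hx | hx
      · left; constructor <;> nlinarith
      · right; constructor <;> nlinarith
    have e1 : x -ᵥ (t • x + (1 - t) • y) = (1 - t) • (x - y) := by
      rw [vsub_eq_sub]; module
    have e2 : (t • x + (1 - t) • y) -ᵥ y = t • (x - y) := by
      rw [vsub_eq_sub]; module
    rw [e1, e2]
    exact (SameRay.refl _).nonneg_smul_left ht1 |>.nonneg_smul_right ht0

/-- Two points on the same side of a line are equal if they have the same distances to two points
of the line. -/
theorem eq_of_dist_eq_of_sOppSide {a b x y z : Plane} (hab : a ≠ b)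
    (hx : (affineSpan ℝ {a, b}).SOppSide z x) (hy : (affineSpan ℝ {a, b}).SOppSide z y)
    (ha : dist a x = dist a y) (hb : dist b x = dist b y) : x = y := by
  rw [sOppSide_line_iff hab] at hx hy
  have hsq : cross a b x ^ 2 = cross a b y ^ 2 := by
    have h1 := four_mul_cross_sq a b x
    rw [ha, hb, ← four_mul_cross_sq] at h1
    linarith
  -- Heron fixes the signed area up to sign; being opposite to the same `z` fixes the sign.
  have hxy : cross a b x = cross a b y := by
    rcases sq_eq_sq_iff_eq_or_eq_neg.1 hsq with h | h
    · exact h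
    · rw [h] at hx
      linarith
  have ha' := congrArg (· ^ 2) ha
  have hb' := congrArg (· ^ 2) hb
  simp only [dist_sq_plane] at ha' hb'
  have hd : (b 0 - a 0) ^ 2 + (b 1 - a 1) ^ 2 ≠ 0 := by
    rw [← dist_sq_plane]
    exact pow_ne_zero _ (dist_ne_zero.2 hab.symm)
  have e1 : (b 0 - a 0) * (x 0 - y 0) + (b 1 - a 1) * (x 1 - y 1) = 0 := by linarith
  have e2 : (b 0 - a 0) * (x 1 - y 1) - (b 1 - a 1) * (x 0 - y 0) = 0 := by
    unfold cross at hxy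
    linarith
  refine plane_ext ?_ ?_
  · refine sub_eq_zero.1 ((mul_eq_zero.1 ?_).resolve_left hd)
    linear_combination (b 0 - a 0) * e1 - (b 1 - a 1) * e2
  · refine sub_eq_zero.1 ((mul_eq_zero.1 ?_).resolve_left hd)
    linear_combination (b 1 - a 1) * e1 + (b 0 - a 0) * e2

/-- By Mazur–Ulam the isometry is affine, and affine equivalences preserve sides. -/
theorem sOppSide_map_isometryEquiv (g : Plane ≃ᵢ Plane) {a b x y : Plane}
    (h : (affineSpan ℝ {a, b}).SOppSide x y) :
    (affineSpan ℝ {g a, g b}).SOppSide (g x) (g y) := by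
  have := (g.toRealAffineIsometryEquiv.toAffineEquiv.sOppSide_map_iff).2 h
  rw [AffineSubspace.map_span] at this
  simpa [Set.image_pair] using this

/-! ### Connected graphs of degree at most two -/

section Graph

variable {V : Type*} {G : SimpleGraph V}

/-- The vertices `u 0, …, u m` form an injective path. -/
structure IsPathSeq (G : SimpleGraph V) (m : ℕ) (u : ℕ → V) : Prop where
  inj : ∀ i ≤ m, ∀ j ≤ m, u i = u j → i = j
  adj : ∀ i < m, G.Adj (u i) (u (i + 1))

theorem IsPathSeq.reverse {m : ℕ} {u : ℕ → V} (h : IsPathSeq G m u) :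
    IsPathSeq G m fun i => u (m - i) where
  inj i hi j hj hij := by
    have := h.inj (m - i) (by omega) (m - j) (by omega) hij
    omega
  adj i hi := by
    have := (h.adj (m - (i + 1)) (by omega)).symm
    rwa [show m - (i + 1) + 1 = m - i by omega] at this

theorem IsPathSeq.extend {m : ℕ} {u : ℕ → V} (h : IsPathSeq G m u) {y : V}
    (hy : G.Adj (u m) y) (hne : ∀ i ≤ m, u i ≠ y) :
    IsPathSeq G (m + 1) fun i => if i ≤ m then u i else y where
  inj i hi j hj hij := by
    by_cases h1 : i ≤ m <;> by_cases h2 : j ≤ m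
    · simp only [h1, h2, if_true] at hij
      exact h.inj i h1 j h2 hij
    · simp only [h1, h2, if_true, if_false] at hij
      exact absurd hij (hne i h1)
    · simp only [h1, h2, if_true, if_false] at hij
      exact absurd hij.symm (hne j h2)
    · omega
  adj i hi := by
    by_cases h1 : i < m
    · have h2 : i ≤ m := by omega
      have h3 : i + 1 ≤ m := by omega
      simpa [h2, h3] using h.adj i h1
    · obtain rfl : i = m := by omega
      simpa using hy

theorem exists_maximal_pathSeq [Finite V] {a b : V} (hab : G.Adj a b) :
    ∃ m u, 1 ≤ m ∧ IsPathSeq G m u ∧ ∀ w, ¬ IsPathSeq G (m + 1) w := by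
  cases nonempty_fintype V
  classical
  have h1 : ∃ w, IsPathSeq G 1 w :=
    ⟨fun i => if i = 0 then a else b, ⟨fun i hi j hj hij => by
      interval_cases i <;> interval_cases j <;> simp_all [hab.ne, hab.ne.symm], fun i hi => by
      interval_cases i
      simpa using hab⟩⟩
  have hb : ∀ m, (∃ w, IsPathSeq G m w) → m ≤ Fintype.card V := by
    rintro m ⟨w, hw⟩
    have := Finset.card_le_card_of_injOn (s := Finset.range (m + 1)) (t := Finset.univ) w
      (fun _ _ => Finset.mem_coe.2 (Finset.mem_univ _)) fun i hi j hj hij => by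
        simp only [Finset.coe_range, Set.mem_Iio] at hi hj
        exact hw.inj i (by omega) j (by omega) hij
    simp only [Finset.card_range, Finset.card_univ] at this
    omega
  obtain ⟨u, hu⟩ := Nat.findGreatest_spec (P := fun m => ∃ w, IsPathSeq G m w) (hb 1 h1) h1
  refine ⟨_, u, Nat.le_findGreatest (hb 1 h1) h1, hu, fun w hw => ?_⟩
  have := Nat.le_findGreatest (P := fun m => ∃ w, IsPathSeq G m w) (hb _ ⟨w, hw⟩) ⟨w, hw⟩
  omega

theorem IsPathSeq.mem_of_adj_last {m : ℕ} {u : ℕ → V} (h : IsPathSeq G m u)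
    (hmax : ∀ w, ¬ IsPathSeq G (m + 1) w) {y : V} (hy : G.Adj (u m) y) : ∃ i ≤ m, u i = y := by
  by_contra! hne
  exact hmax _ (h.extend hy hne)

theorem IsPathSeq.mem_of_adj_first {m : ℕ} {u : ℕ → V} (h : IsPathSeq G m u)
    (hmax : ∀ w, ¬ IsPathSeq G (m + 1) w) {y : V} (hy : G.Adj (u 0) y) : ∃ i ≤ m, u i = y := by
  obtain ⟨i, -, hi'⟩ := h.reverse.mem_of_adj_last hmax (y := y) (by simpa using hy)
  exact ⟨m - i, by omega, hi'⟩

/-- Any other chord would end at an inner vertex of the path and give it a third neighbour. -/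
theorem IsPathSeq.adj_iff
    (hdeg : ∀ u x y z, G.Adj u x → G.Adj u y → G.Adj u z → x = y ∨ y = z ∨ x = z)
    {m : ℕ} {u : ℕ → V} (h : IsPathSeq G m u) {i j : ℕ} (hij : i < j)
    (hj : j ≤ m) (hadj : G.Adj (u i) (u j)) : j = i + 1 ∨ (i = 0 ∧ j = m) := by
  by_contra! hne
  by_cases hi : i = 0
  · have h1 := h.adj j (by omega)
    have h2 := h.adj (j - 1) (by omega)
    rw [Nat.sub_add_cancel (by omega)] at h2
    rcases hdeg _ _ _ _ hadj.symm h1 h2.symm with h3 | h3 | h3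
    · have := h.inj _ (by omega) _ (by omega) h3; omega
    · have := h.inj _ (by omega) _ (by omega) h3; omega
    · have := h.inj _ (by omega) _ (by omega) h3; omega
  · have h1 := h.adj i (by omega)
    have h2 := h.adj (i - 1) (by omega)
    rw [Nat.sub_add_cancel (by omega)] at h2
    rcases hdeg _ _ _ _ hadj h1 h2.symm with h3 | h3 | h3
    · have := h.inj _ (by omega) _ (by omega) h3; omega
    · have := h.inj _ (by omega) _ (by omega) h3; omega
    · have := h.inj _ (by omega) _ (by omega) h3; omega

/-- A maximal path is closed under adjacency: inner vertices already have their two neighbours on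
it, and a new neighbour of an end would extend it. By connectedness it then meets every non-isolated
vertex. -/
theorem IsPathSeq.mem_of_adj
    (hdeg : ∀ u x y z, G.Adj u x → G.Adj u y → G.Adj u z → x = y ∨ y = z ∨ x = z)
    {m : ℕ} {u : ℕ → V} (h : IsPathSeq G m u)
    (hmax : ∀ w, ¬ IsPathSeq G (m + 1) w) {i : ℕ} (hi : i ≤ m) {y : V} (hy : G.Adj (u i) y) :
    ∃ j ≤ m, u j = y := by
  by_cases h0 : i = 0
  · exact h.mem_of_adj_first hmax (h0 ▸ hy)
  by_cases hm : i = m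
  · exact h.mem_of_adj_last hmax (hm ▸ hy)
  have h1 := h.adj i (by omega)
  have h2 := h.adj (i - 1) (by omega)
  rw [Nat.sub_add_cancel (by omega)] at h2
  rcases hdeg _ _ _ _ hy h1 h2.symm with h3 | h3 | h3
  · exact ⟨i + 1, by omega, h3.symm⟩
  · have := h.inj _ (by omega) _ (by omega) h3; omega
  · exact ⟨i - 1, by omega, h3.symm⟩

/-- In a connected graph of degree at most two with angles on the edges, that sum up to `2 * π` if
all degrees are two, the vertices can be placed on the unit circle such that consecutive vertices
differ by the angle of their edge. The relation `N` is the counterclockwise orientation. -/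
theorem exists_angles [Finite V]
    (hdeg : ∀ u x y z, G.Adj u x → G.Adj u y → G.Adj u z → x = y ∨ y = z ∨ x = z)
    (hne : ∃ a b, G.Adj a b)
    (hconn : ∀ u w x y, G.Adj u x → G.Adj w y → G.Reachable u w)
    (θ : V → V → ℝ)
    (hsum : (∀ x y, G.Adj x y → ∃ z, z ≠ y ∧ G.Adj x z) → ∀ s : Finset (V × V),
      (∀ x y, G.Adj x y ↔ (x, y) ∈ s ∨ (y, x) ∈ s) → (∀ x y, (x, y) ∈ s → (y, x) ∉ s) →
      ∑ p ∈ s, θ p.1 p.2 = 2 * Real.pi) :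
    ∃ (a : V → ℝ) (N : V → V → Prop), (∀ x y, G.Adj x y → N x y ∨ N y x) ∧
      (∀ x y z, N x y → N x z → y = z) ∧ (∀ x y z, N y x → N z x → y = z) ∧
      (∀ x y, N x y → Real.cos (a y - a x) = Real.cos (θ x y) ∧
        Real.sin (a y - a x) = Real.sin (θ x y)) := by
  classical
  obtain ⟨x₀, y₀, hxy₀⟩ := hne
  obtain ⟨m, u, hm, hu, hmax⟩ := exists_maximal_pathSeq hxy₀
  have hcover : ∀ x y, G.Adj x y → ∃ i ≤ m, u i = x := by
    intro x y hxy
    obtain ⟨p⟩ := hconn (u 0) x _ y (hu.adj 0 (by omega)) hxy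
    have key : ∀ {v w : V}, G.Walk v w → (∃ i ≤ m, u i = v) → ∃ i ≤ m, u i = w := by
      intro v w p
      induction p with
      | nil => exact id
      | cons hadj _ ih =>
        rintro ⟨i, hi, rfl⟩
        exact ih (hu.mem_of_adj hdeg hmax hi hadj)
    exact key p ⟨0, by omega, rfl⟩
  have hpair : ∀ x y, G.Adj x y → ∃ i j, i ≤ m ∧ j ≤ m ∧ u i = x ∧ u j = y := by
    intro x y hxy
    obtain ⟨i, hi, hi'⟩ := hcover x y hxy
    obtain ⟨j, hj, hj'⟩ := hcover y x hxy.symm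
    exact ⟨i, j, hi, hj, hi', hj'⟩
  let A : ℕ → ℝ := fun i => ∑ j ∈ Finset.range i, θ (u j) (u (j + 1))
  obtain ⟨a, ha⟩ : ∃ a : V → ℝ, ∀ i ≤ m, a (u i) = A i := by
    refine ⟨fun x => if h : ∃ i ≤ m, u i = x then A h.choose else 0, fun i hi => ?_⟩
    have h : ∃ j ≤ m, u j = u i := ⟨i, hi, rfl⟩
    simp only [dif_pos h]
    rw [hu.inj _ h.choose_spec.1 _ hi h.choose_spec.2]
  have hstep : ∀ i < m, a (u (i + 1)) - a (u i) = θ (u i) (u (i + 1)) := by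
    intro i hi
    rw [ha i hi.le, ha (i + 1) hi]
    simp [A, Finset.sum_range_succ]
  -- Circle or arc. The bound `2 ≤ m` excludes a single edge, whose ends are adjacent without
  -- closing a cycle.
  by_cases hc : 2 ≤ m ∧ G.Adj (u m) (u 0)
  · have htwo : ∀ x y, G.Adj x y → ∃ z, z ≠ y ∧ G.Adj x z := by
      intro x y hxy
      obtain ⟨i, hi, rfl⟩ := hcover x y hxy
      obtain ⟨p, q, hpq, hp, hq⟩ : ∃ p q, p ≠ q ∧ G.Adj (u i) p ∧ G.Adj (u i) q := by
        by_cases h0 : i = 0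
        · subst h0
          refine ⟨u 1, u m, fun h => ?_, hu.adj 0 (by omega), hc.2.symm⟩
          have := hu.inj _ (by omega) _ (by omega) h
          omega
        have h2 := hu.adj (i - 1) (by omega)
        rw [Nat.sub_add_cancel (by omega)] at h2
        by_cases hm' : i = m
        · subst hm'
          refine ⟨u 0, u (i - 1), fun h => ?_, hc.2, h2.symm⟩
          have := hu.inj _ (by omega) _ (by omega) h
          omega
        · refine ⟨u (i + 1), u (i - 1), fun h => ?_, hu.adj i (by omega), h2.symm⟩
          have := hu.inj _ (by omega) _ (by omega) h
          omega
      by_cases hpy : p = y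
      · exact ⟨q, fun h => hpq (hpy.trans h.symm), hq⟩
      · exact ⟨p, hpy, hp⟩
    -- Every edge once, oriented along the cycle.
    let s : Finset (V × V) := insert (u m, u 0)
      ((Finset.range m).image fun i => (u i, u (i + 1)))
    have hs : ∀ x y, (x, y) ∈ s ↔ (x = u m ∧ y = u 0) ∨ ∃ i < m, u i = x ∧ u (i + 1) = y := by
      intro x y
      simp [s]
    have htotal : A m + θ (u m) (u 0) = 2 * Real.pi := by
      rw [← hsum htwo s ?_ ?_, Finset.sum_insert, Finset.sum_image, add_comm]
      · intro i hi j hj hij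
        simp only [Finset.coe_range, Set.mem_Iio] at hi hj
        exact hu.inj i hi.le j hj.le (Prod.ext_iff.1 hij).1
      · simp only [Finset.mem_image, Finset.mem_range, not_exists, not_and]
        intro i hi h
        have := hu.inj i hi.le m le_rfl (Prod.ext_iff.1 h).1
        omega
      · intro x y
        rw [hs, hs]
        constructor
        · intro hxy
          obtain ⟨i, j, hi, hj, rfl, rfl⟩ := hpair x y hxy
          rcases lt_trichotomy i j with h | h | h
          · rcases hu.adj_iff hdeg h hj hxy with rfl | ⟨rfl, rfl⟩
            · exact Or.inl (Or.inr ⟨i, by omega, rfl, rfl⟩)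
            · exact Or.inr (Or.inl ⟨rfl, rfl⟩)
          · exact absurd (h ▸ hxy) (G.irrefl)
          · rcases hu.adj_iff hdeg h hi hxy.symm with rfl | ⟨rfl, rfl⟩
            · exact Or.inr (Or.inr ⟨j, by omega, rfl, rfl⟩)
            · exact Or.inl (Or.inl ⟨rfl, rfl⟩)
        · rintro ((⟨rfl, rfl⟩ | ⟨i, hi, rfl, rfl⟩) | (⟨rfl, rfl⟩ | ⟨i, hi, rfl, rfl⟩))
          exacts [hc.2, hu.adj i hi, hc.2.symm, (hu.adj i hi).symm]
      · intro x y
        rw [hs, hs]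
        rintro (⟨rfl, rfl⟩ | ⟨i, hi, rfl, rfl⟩) (⟨h1, h2⟩ | ⟨j, hj, h1, h2⟩)
        · have := hu.inj _ (by omega) _ (by omega) h1; omega
        · have := hu.inj _ (by omega) _ (by omega) h1
          have := hu.inj _ (by omega) _ (by omega) h2; omega
        · have := hu.inj _ (by omega) _ (by omega) h1
          have := hu.inj _ (by omega) _ (by omega) h2; omega
        · have := hu.inj _ (by omega) _ (by omega) h1
          have := hu.inj _ (by omega) _ (by omega) h2; omega
    refine ⟨a, fun x y => (x = u m ∧ y = u 0) ∨ ∃ i < m, u i = x ∧ u (i + 1) = y, ?_, ?_, ?_, ?_⟩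
    · intro x y hxy
      obtain ⟨i, j, hi, hj, rfl, rfl⟩ := hpair x y hxy
      rcases lt_trichotomy i j with h | h | h
      · rcases hu.adj_iff hdeg h hj hxy with rfl | ⟨rfl, rfl⟩
        · exact Or.inl (Or.inr ⟨i, by omega, rfl, rfl⟩)
        · exact Or.inr (Or.inl ⟨rfl, rfl⟩)
      · exact absurd (h ▸ hxy) (G.irrefl)
      · rcases hu.adj_iff hdeg h hi hxy.symm with rfl | ⟨rfl, rfl⟩
        · exact Or.inr (Or.inr ⟨j, by omega, rfl, rfl⟩)
        · exact Or.inl (Or.inl ⟨rfl, rfl⟩)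
    · rintro x y z (⟨rfl, rfl⟩ | ⟨i, hi, rfl, rfl⟩) (⟨h1, rfl⟩ | ⟨j, hj, h1, rfl⟩)
      · rfl
      · have := hu.inj _ (by omega) _ (by omega) h1; omega
      · have := hu.inj _ (by omega) _ (by omega) h1; omega
      · rw [hu.inj _ (by omega) _ (by omega) h1]
    · rintro x y z (⟨rfl, rfl⟩ | ⟨i, hi, rfl, rfl⟩) (⟨rfl, h1⟩ | ⟨j, hj, rfl, h1⟩)
      · rfl
      · have := hu.inj _ (by omega) _ (by omega) h1; omega
      · have := hu.inj _ (by omega) _ (by omega) h1; omega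
      · have := hu.inj _ (by omega) _ (by omega) h1
        rw [show i = j by omega]
    · rintro x y (⟨rfl, rfl⟩ | ⟨i, hi, rfl, rfl⟩)
      · have : a (u 0) - a (u m) = θ (u m) (u 0) - 2 * Real.pi := by
          rw [ha 0 (by omega), ha m le_rfl, ← htotal]
          simp [A]
        rw [this, Real.cos_sub_two_pi, Real.sin_sub_two_pi]
        exact ⟨rfl, rfl⟩
      · rw [hstep i hi]
        exact ⟨rfl, rfl⟩
  · have hcon : ∀ i j, i < j → j ≤ m → G.Adj (u i) (u j) → j = i + 1 := by
      intro i j hij hj hadj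
      rcases hu.adj_iff hdeg hij hj hadj with h | ⟨rfl, rfl⟩
      · exact h
      · by_contra hne
        exact hc ⟨by omega, hadj.symm⟩
    refine ⟨a, fun x y => ∃ i < m, u i = x ∧ u (i + 1) = y, ?_, ?_, ?_, ?_⟩
    · intro x y hxy
      obtain ⟨i, j, hi, hj, rfl, rfl⟩ := hpair x y hxy
      rcases lt_trichotomy i j with h | h | h
      · obtain rfl := hcon i j h hj hxy
        exact Or.inl ⟨i, by omega, rfl, rfl⟩
      · exact absurd (h ▸ hxy) (G.irrefl)
      · obtain rfl := hcon j i h hi hxy.symm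
        exact Or.inr ⟨j, by omega, rfl, rfl⟩
    · rintro x y z ⟨i, hi, rfl, rfl⟩ ⟨j, hj, h1, rfl⟩
      rw [hu.inj _ (by omega) _ (by omega) h1]
    · rintro x y z ⟨i, hi, rfl, rfl⟩ ⟨j, hj, rfl, h1⟩
      have := hu.inj _ (by omega) _ (by omega) h1
      rw [show i = j by omega]
    · rintro x y ⟨i, hi, rfl, rfl⟩
      rw [hstep i hi]
      exact ⟨rfl, rfl⟩

end Graph

/-! ### Triangles at an edge -/

section Combinatorics

variable {V : Type*} [DecidableEq V] {S : AbstractSimplicialComplex V}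

theorem ne_of_mem_triangles {u v w : V} (h : {u, v, w} ∈ triangles S) :
    u ≠ v ∧ u ≠ w ∧ v ≠ w := by
  have h3 := h.2
  refine ⟨?_, ?_, ?_⟩ <;> rintro rfl
  · rw [Finset.insert_eq_of_mem (by simp)] at h3
    exact absurd h3 (Finset.card_le_two.trans_lt (by norm_num)).ne
  · rw [Finset.insert_eq_of_mem (by simp)] at h3
    exact absurd h3 (Finset.card_le_two.trans_lt (by norm_num)).ne
  · rw [Finset.insert_eq_of_mem (a := v) (by simp)] at h3
    exact absurd h3 (Finset.card_le_two.trans_lt (by norm_num)).ne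

theorem pair_mem_edges {T : Finset V} (hT : T ∈ triangles S) {u v : V} (hu : u ∈ T) (hv : v ∈ T)
    (h : u ≠ v) : {u, v} ∈ edges S :=
  ⟨face_of_subset hT.1 (by simp [Finset.insert_subset_iff, hu, hv]) (by simp),
    Finset.card_pair h⟩

theorem ne_of_mem_edges {u v : V} (h : {u, v} ∈ edges S) : u ≠ v := by
  rintro rfl
  have := h.2
  simp at this

theorem triangle_perm {u v w : V} (h : {u, v, w} ∈ triangles S) : {v, u, w} ∈ triangles S := by
  rwa [Finset.insert_comm]

theorem triangle_perm' {u v w : V} (h : {u, v, w} ∈ triangles S) : {u, w, v} ∈ triangles S := by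
  rwa [Finset.pair_comm]

theorem exists_third_vertex {T : Finset V} (hT : T ∈ triangles S) {u v : V} (hu : u ∈ T)
    (hv : v ∈ T) (h : u ≠ v) : ∃ w, T = {u, v, w} := by
  have hc : (T \ {u, v}).card = 1 := by
    rw [Finset.card_sdiff_of_subset (by simp [Finset.insert_subset_iff, hu, hv]), hT.2,
      Finset.card_pair h]
  obtain ⟨w, hw⟩ := Finset.card_eq_one.1 hc
  refine ⟨w, ?_⟩
  rw [← Finset.union_sdiff_of_subset (s := {u, v}) (t := T)
    (by simp [Finset.insert_subset_iff, hu, hv]), hw]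
  ext x
  simp

theorem exists_eq_triple {T : Finset V} (hT : T ∈ triangles S) {u : V} (hu : u ∈ T) :
    ∃ v w, T = {u, v, w} := by
  obtain ⟨v, hv, hne⟩ := Finset.exists_mem_ne (by rw [hT.2]; norm_num) u
  obtain ⟨w, hw⟩ := exists_third_vertex hT hu hv hne.symm
  exact ⟨v, w, hw⟩

theorem triple_injective {u v x y : V} (hx : {u, v, x} ∈ triangles S)
    (h : ({u, v, x} : Finset V) = {u, v, y}) : x = y := by
  have hm : x ∈ ({u, v, y} : Finset V) := h ▸ by simp
  have := ne_of_mem_triangles hx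
  simp only [Finset.mem_insert, Finset.mem_singleton] at hm
  rcases hm with hm | hm | hm
  · exact absurd hm.symm this.2.1
  · exact absurd hm.symm this.2.2
  · exact hm

variable [Fintype V]

theorem IsCombinatorialClosedDisk.exists_triangle_of_edge (hS : IsCombinatorialClosedDisk S)
    {u v : V} (h : {u, v} ∈ edges S) : ∃ w, {u, v, w} ∈ triangles S := by
  have hne : (trianglesAt S {u, v}).Nonempty := by
    rw [Set.nonempty_iff_ne_empty]
    intro h0
    rcases hS.edge_triangles _ h with h1 | h1 <;> simp [h0] at h1
  obtain ⟨T, hT, hsub⟩ := hne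
  simp only [Finset.insert_subset_iff, Finset.singleton_subset_iff] at hsub
  obtain ⟨w, rfl⟩ := exists_third_vertex hT hsub.1 hsub.2 (ne_of_mem_edges h)
  exact ⟨w, hT⟩

theorem IsCombinatorialClosedDisk.eq_or_eq_or_eq (hS : IsCombinatorialClosedDisk S)
    {u v x y z : V} (hx : {u, v, x} ∈ triangles S) (hy : {u, v, y} ∈ triangles S)
    (hz : {u, v, z} ∈ triangles S) : x = y ∨ y = z ∨ x = z := by
  by_contra! hne
  have he : {u, v} ∈ edges S := pair_mem_edges hx (by simp) (by simp) (ne_of_mem_triangles hx).1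
  have hsub : ({{u, v, x}, {u, v, y}, {u, v, z}} : Set (Finset V)) ⊆ trianglesAt S {u, v} := by
    rintro T (rfl | rfl | rfl)
    exacts [⟨hx, by simp [Finset.insert_subset_iff]⟩, ⟨hy, by simp [Finset.insert_subset_iff]⟩,
      ⟨hz, by simp [Finset.insert_subset_iff]⟩]
  have h3 := Set.ncard_le_ncard hsub (Set.toFinite _)
  rw [Set.ncard_insert_of_notMem, Set.ncard_pair] at h3
  · rcases hS.edge_triangles _ he with h1 | h1 <;> omega
  · exact fun h => hne.2.1 (triple_injective hy h)
  · rintro (h | h)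
    · exact hne.1 (triple_injective hx h)
    · exact hne.2.2 (triple_injective hx h)

/-- Otherwise being equal to `v` would be constant along edges, so by connectedness `v` would be the
only vertex, although a boundary edge has two. -/
theorem IsCombinatorialClosedDisk.exists_edge (hS : IsCombinatorialClosedDisk S) (v : V) :
    ∃ u, {v, u} ∈ edges S := by
  have := hS.simplyConnected
  by_contra! hno
  obtain ⟨e, ⟨he, -⟩⟩ := hS.boundary_nonempty
  obtain ⟨x, y, hxy, rfl⟩ := Finset.card_eq_two.1 he.2
  have key : ∀ w, w = v := by
    intro w
    have := eq_of_eq_on_edges (S := S) (fun w => w = v) (fun a b hab => ?_) v w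
    · exact this.mp rfl
    · refine propext ⟨?_, ?_⟩ <;> rintro rfl
      · exact absurd hab (hno b)
      · rw [Finset.pair_comm] at hab
        exact absurd hab (hno a)
  exact hxy ((key x).trans (key y).symm)

theorem IsCombinatorialClosedDisk.exists_triangle_of_face (hS : IsCombinatorialClosedDisk S)
    {s : Finset V} (hs : s ∈ S.faces) : ∃ T ∈ triangles S, s ⊆ T := by
  have h0 : 0 < s.card := Finset.card_pos.2 (S.isRelLowerSet_faces hs).1
  have h3 := hS.card_le_three s hs
  have h2 : ∀ {u v : V}, {u, v} ∈ edges S → ∃ T ∈ triangles S, {u, v} ⊆ T := by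
    intro u v h
    obtain ⟨w, hw⟩ := hS.exists_triangle_of_edge h
    exact ⟨_, hw, by simp [Finset.insert_subset_iff]⟩
  obtain h | h | h : s.card = 1 ∨ s.card = 2 ∨ s.card = 3 := by omega
  · obtain ⟨v, rfl⟩ := Finset.card_eq_one.1 h
    obtain ⟨u, hu⟩ := hS.exists_edge v
    obtain ⟨T, hT, hsub⟩ := h2 hu
    exact ⟨T, hT, (Finset.singleton_subset_iff.2 (hsub (by simp)))⟩
  · obtain ⟨u, v, -, rfl⟩ := Finset.card_eq_two.1 h
    exact h2 ⟨hs, h⟩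
  · exact ⟨s, ⟨hs, h⟩, subset_rfl⟩

end Combinatorics

/-! ### Placements of triangles -/

section Placement

variable {V : Type*} [DecidableEq V] {S : AbstractSimplicialComplex V} {len : Finset V → ℝ}

/-- The lengths `len` satisfy the strict triangle inequalities in the triangles of `S`. -/
def TriangleLT (S : AbstractSimplicialComplex V) (len : Finset V → ℝ) : Prop :=
  ∀ u v w : V, {u, v, w} ∈ triangles S → len {u, w} < len {u, v} + len {v, w}

theorem TriangleLT.perm (h : TriangleLT S len) {u v w : V} (hT : {u, v, w} ∈ triangles S) :
    len {u, v} < len {u, w} + len {v, w} ∧ len {u, w} < len {u, v} + len {v, w} ∧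
      len {v, w} < len {u, v} + len {u, w} := by
  have h1 := h u w v (triangle_perm' hT)
  have h2 := h v u w (triangle_perm hT)
  rw [Finset.pair_comm w v] at h1
  rw [Finset.pair_comm v u] at h2
  exact ⟨h1, h u v w hT, h2⟩

theorem TriangleLT.pos (h : TriangleLT S len) {u v w : V} (hT : {u, v, w} ∈ triangles S) :
    0 < len {u, v} ∧ 0 < len {u, w} ∧ 0 < len {v, w} := by
  obtain ⟨h1, h2, h3⟩ := h.perm hT
  refine ⟨?_, ?_, ?_⟩ <;> linarith

/-- The map `P` realizes the edge lengths of the triangle `T`. -/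
def Places (len : Finset V → ℝ) (T : Finset V) (P : V → Plane) : Prop :=
  ∀ x ∈ T, ∀ y ∈ T, x ≠ y → dist (P x) (P y) = len {x, y}

/-- The map `P` places the triangles at the edge `vw` without folding. -/
def UnfoldedAt (S : AbstractSimplicialComplex V) (v w : V) (P : V → Plane) : Prop :=
  ∀ x y, x ≠ y → {v, w, x} ∈ triangles S → {v, w, y} ∈ triangles S →
    (affineSpan ℝ {P v, P w}).SOppSide (P x) (P y)

theorem UnfoldedAt.symm {v w : V} {P : V → Plane} (h : UnfoldedAt S v w P) :
    UnfoldedAt S w v P := by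
  intro x y hxy hx hy
  rw [Set.pair_comm]
  exact h x y hxy (triangle_perm hx) (triangle_perm hy)

theorem UnfoldedAt.comp {v w : V} {P : V → Plane} (h : UnfoldedAt S v w P)
    (g : Plane ≃ᵢ Plane) : UnfoldedAt S v w (g ∘ P) :=
  fun x y hxy hx hy => sOppSide_map_isometryEquiv g (h x y hxy hx hy)

theorem Places.comp {T : Finset V} {P : V → Plane} (h : Places len T P)
    (g : Plane ≃ᵢ Plane) : Places len T (g ∘ P) :=
  fun x hx y hy hxy => (g.dist_eq _ _).trans (h x hx y hy hxy)

/-- The map `P` places the triangles at the vertex `v` without folding. -/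
structure IsStarPlacement (S : AbstractSimplicialComplex V) (len : Finset V → ℝ) (v : V)
    (P : V → Plane) : Prop where
  places : ∀ T ∈ triangles S, v ∈ T → Places len T P
  unfolded : ∀ w, UnfoldedAt S v w P

theorem Places.cross_ne_zero (hlen : TriangleLT S len) {a b c : V} {P : V → Plane}
    (hT : {a, b, c} ∈ triangles S) (h : Places len {a, b, c} P) :
    cross (P a) (P b) (P c) ≠ 0 := by
  obtain ⟨h1, h2, h3⟩ := hlen.perm hT
  obtain ⟨hab, hac, hbc⟩ := ne_of_mem_triangles hT
  rw [← h a (by simp) b (by simp) hab, ← h a (by simp) c (by simp) hac,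
    ← h b (by simp) c (by simp) hbc] at h1 h2 h3
  exact cross_ne_zero_of_triangle_lt h1 h2 h3

/-- The rigidity behind all gluing: transition isometries can be compared on one common triangle. -/
theorem Places.isometryEquiv_eq (hlen : TriangleLT S len) {T : Finset V} {P : V → Plane}
    (hT : T ∈ triangles S) (h : Places len T P) {g g' : Plane ≃ᵢ Plane}
    (hg : ∀ t ∈ T, g (P t) = g' (P t)) : g = g' := by
  obtain ⟨u, hu⟩ : T.Nonempty := Finset.card_pos.1 (by rw [hT.2]; norm_num)
  obtain ⟨v, w, rfl⟩ := exists_eq_triple hT hu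
  exact DiscreteConformal.isometryEquiv_eq (h.cross_ne_zero hlen hT) (hg _ (by simp))
    (hg _ (by simp)) (hg _ (by simp))

/-- Two placements of the triangles at an edge differ by an isometry. -/
theorem exists_isometryEquiv_of_unfoldedAt (hlen : TriangleLT S len) {v w : V} (hvw : v ≠ w)
    {P Q : V → Plane} (hP : ∀ T ∈ triangles S, v ∈ T → w ∈ T → Places len T P)
    (hQ : ∀ T ∈ triangles S, v ∈ T → w ∈ T → Places len T Q)
    (hP' : UnfoldedAt S v w P) (hQ' : UnfoldedAt S v w Q) :
    ∃ g : Plane ≃ᵢ Plane, ∀ T ∈ triangles S, v ∈ T → w ∈ T → ∀ t ∈ T, g (P t) = Q t := by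
  by_cases hno : ∃ x, {v, w, x} ∈ triangles S
  swap
  · refine ⟨1, fun T hT hv hw => ?_⟩
    obtain ⟨x, rfl⟩ := exists_third_vertex hT hv hw hvw
    exact absurd ⟨x, hT⟩ hno
  obtain ⟨x, hx⟩ := hno
  obtain ⟨-, hvx, hwx⟩ := ne_of_mem_triangles hx
  have hPx := hP _ hx (by simp) (by simp)
  have hQx := hQ _ hx (by simp) (by simp)
  have hdist : ∀ {a b c}, Places len {a, b, c} P → Places len {a, b, c} Q → a ≠ b → a ≠ c → b ≠ c →
      dist (P a) (P b) = dist (Q a) (Q b) ∧ dist (P a) (P c) = dist (Q a) (Q c) ∧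
        dist (P b) (P c) = dist (Q b) (Q c) := by
    intro a b c hp hq hab hac hbc
    refine ⟨?_, ?_, ?_⟩
    · rw [hp a (by simp) b (by simp) hab, hq a (by simp) b (by simp) hab]
    · rw [hp a (by simp) c (by simp) hac, hq a (by simp) c (by simp) hac]
    · rw [hp b (by simp) c (by simp) hbc, hq b (by simp) c (by simp) hbc]
  obtain ⟨d1, d2, d3⟩ := hdist hPx hQx hvw hvx hwx
  -- One triangle at the edge determines `g`. A second third vertex `y` follows along, since `g (P
  -- y)` and `Q y` both lie opposite to `Q x` at equal distances from `Q v` and `Q w`.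
  obtain ⟨g, gv, gw, gx⟩ := exists_isometryEquiv (hPx.cross_ne_zero hlen hx) d1 d2 d3
  refine ⟨g, fun T hT hv hw => ?_⟩
  obtain ⟨y, rfl⟩ := exists_third_vertex hT hv hw hvw
  obtain ⟨-, hvy, hwy⟩ := ne_of_mem_triangles hT
  obtain ⟨-, e2, e3⟩ := hdist (hP _ hT hv hw) (hQ _ hT hv hw) hvw hvy hwy
  have gy : g (P y) = Q y := by
    by_cases hxy : x = y
    · rw [← hxy, gx]
    have hne : Q v ≠ Q w := by
      rw [← dist_ne_zero, hQx v (by simp) w (by simp) hvw]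
      exact (hlen.pos hx).1.ne'
    have hg := sOppSide_map_isometryEquiv g (hP' x y hxy hx hT)
    rw [gv, gw, gx] at hg
    refine eq_of_dist_eq_of_sOppSide hne hg (hQ' x y hxy hx hT) ?_ ?_
    · rw [← gv, g.dist_eq, e2, gv]
    · rw [← gw, g.dist_eq, e3, gw]
  intro t ht
  simp only [Finset.mem_insert, Finset.mem_singleton] at ht
  rcases ht with rfl | rfl | rfl
  exacts [gv, gw, gy]

theorem RealizesLengths.places {p : V → Plane} (h : RealizesLengths S len p) {T : Finset V}
    (hT : T ∈ triangles S) : Places len T p :=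
  fun x hx y hy hxy => (h x y (pair_mem_edges hT hx hy hxy)).symm

variable [Fintype V]

/-- Two placements of the star of a vertex differ by an isometry. -/
theorem IsStarPlacement.exists_isometryEquiv (hS : IsCombinatorialClosedDisk S)
    (hlen : TriangleLT S len) {v : V} {P Q : V → Plane} (hP : IsStarPlacement S len v P)
    (hQ : IsStarPlacement S len v Q) :
    ∃ g : Plane ≃ᵢ Plane, ∀ T ∈ triangles S, v ∈ T → ∀ t ∈ T, g (P t) = Q t := by
  have hedge : ∀ w, v ≠ w →
      ∃ g : Plane ≃ᵢ Plane, ∀ T ∈ triangles S, v ∈ T → w ∈ T → ∀ t ∈ T, g (P t) = Q t :=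
    fun w hw => exists_isometryEquiv_of_unfoldedAt hlen hw (fun T hT hv _ => hP.places T hT hv)
      (fun T hT hv _ => hQ.places T hT hv) (hP.unfolded w) (hQ.unfolded w)
  obtain ⟨u, hu⟩ := hS.exists_edge v
  obtain ⟨g, hg⟩ := hedge u (ne_of_mem_edges hu)
  -- Along a walk in the link, consecutive edges at `v` share a triangle, which forces their
  -- isometries to coincide.
  have key : ∀ {x y : V}, (linkGraph S v).Walk x y →
      (∀ T ∈ triangles S, v ∈ T → x ∈ T → ∀ t ∈ T, g (P t) = Q t) →
      ∀ T ∈ triangles S, v ∈ T → y ∈ T → ∀ t ∈ T, g (P t) = Q t := by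
    intro x y p
    induction p with
    | nil => exact id
    | @cons x z _ hadj _ ih =>
      intro hx
      apply ih
      obtain ⟨g', hg'⟩ := hedge z (ne_of_mem_triangles hadj.2).2.1
      have : g = g' := (hP.places _ hadj.2 (by simp)).isometryEquiv_eq hlen hadj.2 fun t ht =>
        (hx _ hadj.2 (by simp) (by simp) t ht).trans
          (hg' _ hadj.2 (by simp) (by simp) t ht).symm
      rwa [this]
  refine ⟨g, fun T hT hv => ?_⟩
  obtain ⟨w, x, rfl⟩ := exists_eq_triple hT hv
  obtain ⟨p⟩ := hS.link_connected v u w hu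
    (pair_mem_edges hT (by simp) (by simp) (ne_of_mem_triangles hT).1)
  exact key p hg _ hT hv (by simp)

/-- Placements of the whole disk without folding are unique up to isometry. -/
theorem exists_isometryEquiv_of_isUnfolded (hS : IsCombinatorialClosedDisk S)
    (hlen : TriangleLT S len) {p q : V → Plane} (hp : RealizesLengths S len p)
    (hp' : IsUnfolded S p) (hq : RealizesLengths S len q) (hq' : IsUnfolded S q) :
    ∃ g : Plane ≃ᵢ Plane, ∀ v, q v = g (p v) := by
  have := hS.simplyConnected
  have hstar : ∀ v, ∃ g : Plane ≃ᵢ Plane, ∀ T ∈ triangles S, v ∈ T → ∀ t ∈ T, g (p t) = q t :=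
    fun v => IsStarPlacement.exists_isometryEquiv hS hlen
      ⟨fun T hT _ => hp.places hT, fun w => hp' v w⟩ ⟨fun T hT _ => hq.places hT, fun w => hq' v w⟩
  choose g hg using hstar
  have hconst := eq_of_eq_on_edges (S := S) g fun u v huv => by
    obtain ⟨w, hw⟩ := hS.exists_triangle_of_edge huv
    exact (hp.places hw).isometryEquiv_eq hlen hw fun t ht =>
      (hg u _ hw (by simp) t ht).trans (hg v _ hw (by simp) t ht).symm
  rcases isEmpty_or_nonempty V with hV | ⟨⟨v₀⟩⟩
  · exact ⟨1, fun v => hV.elim v⟩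
  refine ⟨g v₀, fun v => ?_⟩
  obtain ⟨T, hT, hsub⟩ := hS.exists_triangle_of_face (S.singleton_mem v)
  have hv : v ∈ T := hsub (by simp)
  rw [hconst v₀ v, hg v T hT hv v hv]

/-- Placements of the stars of all vertices can be glued to a placement of the disk. -/
theorem exists_placement_of_star_placements (hS : IsCombinatorialClosedDisk S)
    (hlen : TriangleLT S len) (hstar : ∀ v, ∃ P, IsStarPlacement S len v P) :
    ∃ p : V → Plane, RealizesLengths S len p ∧ IsUnfolded S p := by
  have := hS.simplyConnected
  choose P hP using hstar
  have hg : ∀ v w, ∃ g : Plane ≃ᵢ Plane, ∀ T ∈ triangles S, v ∈ T → w ∈ T →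
      ∀ t ∈ T, g (P w t) = P v t := by
    intro v w
    by_cases hvw : v = w
    · subst hvw
      exact ⟨1, fun _ _ _ _ _ _ => rfl⟩
    · exact exists_isometryEquiv_of_unfoldedAt hlen hvw (fun T hT _ hw => (hP w).places T hT hw)
        (fun T hT hv _ => (hP v).places T hT hv) ((hP w).unfolded v).symm ((hP v).unfolded w)
  choose g hg using hg
  -- The cocycle identity is checked on a triangle containing the face.
  obtain ⟨h, hh⟩ := exists_coboundary (S := S) g fun s hs u hu v hv w hw => by
    obtain ⟨T, hT, hsub⟩ := hS.exists_triangle_of_face hs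
    refine ((hP w).places T hT (hsub hw)).isometryEquiv_eq hlen hT fun t ht => ?_
    rw [IsometryEquiv.mul_apply, hg v w T hT (hsub hv) (hsub hw) t ht,
      hg u v T hT (hsub hu) (hsub hv) t ht, hg u w T hT (hsub hu) (hsub hw) t ht]
  -- On the star of `v` the glued map is the moved placement `(h v)⁻¹ ∘ P v`, so lengths and
  -- unfoldedness carry over.
  have hstar : ∀ v, ∀ T ∈ triangles S, v ∈ T → ∀ t ∈ T, (h t)⁻¹ (P t t) = (h v)⁻¹ (P v t) := by
    intro v T hT hv t ht
    rw [hh v t (face_of_subset hT.1 (by simp [Finset.insert_subset_iff, hv, ht]) (by simp)),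
      mul_inv_rev, IsometryEquiv.mul_apply, ← hg v t T hT hv ht t ht,
      IsometryEquiv.inv_apply_self]
  refine ⟨fun v => (h v)⁻¹ (P v v), fun v w hvw => ?_, fun v w x y hxy hx hy => ?_⟩
  · obtain ⟨x, hx⟩ := hS.exists_triangle_of_edge hvw
    beta_reduce
    rw [hstar v _ hx (by simp) w (by simp), IsometryEquiv.dist_eq]
    exact ((hP v).places _ hx (by simp) v (by simp) w (by simp) (ne_of_mem_edges hvw)).symm
  · beta_reduce
    rw [hstar v _ hx (by simp) w (by simp), hstar v _ hx (by simp) x (by simp),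
      hstar v _ hy (by simp) y (by simp)]
    exact sOppSide_map_isometryEquiv _ ((hP v).unfolded w x y hxy hx hy)

end Placement

/-! ### Placing the star of a flat vertex -/

section Star

variable {V : Type*} [DecidableEq V] {S : AbstractSimplicialComplex V} {len : Finset V → ℝ}

/-- The strict triangle inequalities keep the quotient strictly between -1 and 1, so `Real.arccos`
truncates nothing and the angle is neither 0 nor `π`. -/
theorem TriangleLT.cos_angleIn (hlen : TriangleLT S len) {v x y : V}
    (hT : {v, x, y} ∈ triangles S) :
    2 * (len {v, x} * len {v, y}) * Real.cos (angleIn len v {v, x, y}) =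
        len {v, x} ^ 2 + len {v, y} ^ 2 - len {x, y} ^ 2 ∧
      0 < Real.sin (angleIn len v {v, x, y}) := by
  obtain ⟨h1, h2, h3⟩ := hlen.perm hT
  obtain ⟨p1, p2, p3⟩ := hlen.pos hT
  obtain ⟨hvx, hvy, hxy⟩ := ne_of_mem_triangles hT
  rw [angleIn_triple len hvx hvy hxy]
  generalize len {v, x} = a at *
  generalize len {v, y} = b at *
  generalize len {x, y} = c at *
  have hab : 0 < 2 * (a * b) := by positivity
  have hlt : (a ^ 2 + b ^ 2 - c ^ 2) / (2 * (a * b)) < 1 := by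
    rw [div_lt_one hab]
    nlinarith [mul_pos (show 0 < c - a + b by linarith) (show 0 < c + a - b by linarith)]
  have hgt : -1 < (a ^ 2 + b ^ 2 - c ^ 2) / (2 * (a * b)) := by
    rw [lt_div_iff₀ hab]
    nlinarith [mul_pos (show 0 < a + b - c by linarith) (show 0 < a + b + c by linarith)]
  constructor
  · rw [Real.cos_arccos hgt.le hlt.le]
    field_simp
  · rw [Real.sin_arccos]
    apply Real.sqrt_pos.2
    nlinarith [mul_pos (sub_pos.2 hlt) (neg_lt_iff_pos_add.1 hgt)]

variable [Fintype V]

open scoped Classical in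
/-- The star of a vertex can be placed in the plane without folding if the vertex is a boundary
vertex or the angles at the vertex add up to `2 * π`. -/
theorem exists_isStarPlacement (hS : IsCombinatorialClosedDisk S) (hlen : TriangleLT S len) (v : V)
    (hv : IsInteriorVertex S v →
      ∑ t ∈ Finset.univ.filter (fun t : Finset V => t ∈ triangles S ∧ v ∈ t), angleIn len v t
        = 2 * Real.pi) :
    ∃ P, IsStarPlacement S len v P := by
  have hadj : ∀ {x y}, (linkGraph S v).Adj x y ↔ {v, x, y} ∈ triangles S :=
    fun {x y} => ⟨fun h => h.2, fun h => ⟨(ne_of_mem_triangles h).2.2, h⟩⟩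
  have hedge : ∀ {x y}, (linkGraph S v).Adj x y → {v, x} ∈ edges S := fun h =>
    pair_mem_edges h.2 (by simp) (by simp) (ne_of_mem_triangles h.2).1
  obtain ⟨u₀, hu₀⟩ := hS.exists_edge v
  obtain ⟨w₀, hw₀⟩ := hS.exists_triangle_of_edge hu₀
  obtain ⟨a, N, hN, hNr, hNl, hNa⟩ := exists_angles (G := linkGraph S v)
    (fun u x y z hx hy hz => hS.eq_or_eq_or_eq hx.2 hy.2 hz.2) ⟨u₀, w₀, hadj.2 hw₀⟩
    (fun u w x y hx hy => hS.link_connected v u w (hedge hx) (hedge hy))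
    (fun x y => angleIn len v {v, x, y}) (fun htwo s hs hs' => by
      rw [← hv]
      -- Edges of the link correspond to triangles at `v`; orienting each edge once makes the
      -- correspondence injective.
      · refine Finset.sum_nbij (fun p => {v, p.1, p.2}) ?_ ?_ ?_ fun _ _ => rfl
        · rintro ⟨x, y⟩ hxy
          simpa using hadj.1 ((hs x y).2 (Or.inl hxy))
        · rintro ⟨x, y⟩ hxy ⟨x', y'⟩ hxy' h
          have hT := hadj.1 ((hs x y).2 (Or.inl hxy))
          have hT' := hadj.1 ((hs x' y').2 (Or.inl hxy'))
          have h : ({v, x, y} : Finset V) = {v, x', y'} := h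
          have hx : x ∈ ({v, x', y'} : Finset V) := h ▸ by simp
          simp only [Finset.mem_insert, Finset.mem_singleton] at hx
          rcases hx with hx | rfl | rfl
          · exact absurd hx.symm (ne_of_mem_triangles hT).1
          · rw [triple_injective hT h]
          · rw [Finset.pair_comm x' x] at h
            obtain rfl := triple_injective hT h
            exact absurd hxy' (hs' _ _ hxy)
        · intro T hT
          simp only [Finset.coe_filter, Finset.mem_univ, true_and, Set.mem_ofPred_eq] at hT
          obtain ⟨x, y, rfl⟩ := exists_eq_triple hT.1 hT.2
          rcases (hs x y).1 (hadj.2 hT.1) with h | h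
          · exact ⟨(x, y), h, rfl⟩
          · exact ⟨(y, x), h, by simp only [Finset.pair_comm]⟩
      -- If every vertex of the link with a neighbour has a second one, no edge at `v` lies in just
      -- one triangle, so `v` is interior.
      · rintro e ⟨he, he'⟩ hve
        obtain ⟨x, hx, hne⟩ := Finset.exists_mem_ne (by rw [he.2]; norm_num) v
        have hex : {v, x} = e := Finset.eq_of_subset_of_card_le
          (by simp [Finset.insert_subset_iff, hx, hve]) (by rw [he.2, Finset.card_pair hne.symm])
        subst hex
        obtain ⟨y, hy⟩ := hS.exists_triangle_of_edge he
        obtain ⟨z, hzy, hz⟩ := htwo x y (hadj.2 hy)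
        obtain ⟨T, hT⟩ := Set.ncard_eq_one.1 he'
        have h1 : {v, x, y} ∈ trianglesAt S {v, x} := ⟨hy, by simp [Finset.insert_subset_iff]⟩
        have h2 : {v, x, z} ∈ trianglesAt S {v, x} := ⟨hz.2, by simp [Finset.insert_subset_iff]⟩
        rw [hT, Set.mem_singleton_iff] at h1 h2
        exact hzy (triple_injective hz.2 (h2.trans h1.symm)))
  -- Polar coordinates centred at `v`: the law of cosines gives the lengths of the opposite edges,
  -- and `N` gives the orientation of each triangle.
  let P : V → Plane := fun x =>
    if x = v then 0 else !₂[len {v, x} * Real.cos (a x), len {v, x} * Real.sin (a x)]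
  have hPv : P v = 0 := if_pos rfl
  have hP0 : ∀ {x}, x ≠ v → P x 0 = len {v, x} * Real.cos (a x) := fun h => by simp [P, h]
  have hP1 : ∀ {x}, x ≠ v → P x 1 = len {v, x} * Real.sin (a x) := fun h => by simp [P, h]
  have hvdist : ∀ {x y}, {v, x, y} ∈ triangles S → dist (P v) (P x) = len {v, x} := by
    intro x y hT
    have hx := (ne_of_mem_triangles hT).1.symm
    rw [← sq_eq_sq₀ dist_nonneg (hlen.pos hT).1.le, dist_sq_plane, hPv, hP0 hx, hP1 hx]
    simp only [PiLp.zero_apply]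
    linear_combination len {v, x} ^ 2 * Real.sin_sq_add_cos_sq (a x)
  have hNdist : ∀ {x y}, {v, x, y} ∈ triangles S → N x y → dist (P x) (P y) = len {x, y} := by
    intro x y hT hxy
    have hx := (ne_of_mem_triangles hT).1.symm
    have hy := (ne_of_mem_triangles hT).2.1.symm
    have hcos := (hlen.cos_angleIn hT).1
    rw [← (hNa x y hxy).1, Real.cos_sub] at hcos
    rw [← sq_eq_sq₀ dist_nonneg (hlen.pos hT).2.2.le, dist_sq_plane, hP0 hx, hP1 hx, hP0 hy,
      hP1 hy]
    linear_combination len {v, x} ^ 2 * Real.sin_sq_add_cos_sq (a x)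
      + len {v, y} ^ 2 * Real.sin_sq_add_cos_sq (a y) - hcos
  have hxdist : ∀ {x y}, {v, x, y} ∈ triangles S → dist (P x) (P y) = len {x, y} := by
    intro x y hT
    rcases hN x y (hadj.2 hT) with h | h
    · exact hNdist hT h
    · rw [dist_comm, Finset.pair_comm]
      exact hNdist (triangle_perm' hT) h
  have hcross : ∀ {x y}, {v, x, y} ∈ triangles S → N x y → 0 < cross (P v) (P x) (P y) := by
    intro x y hT hxy
    have hx := (ne_of_mem_triangles hT).1.symm
    have hy := (ne_of_mem_triangles hT).2.1.symm
    have hsin := (hlen.cos_angleIn hT).2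
    rw [← (hNa x y hxy).2, Real.sin_sub] at hsin
    have h := mul_pos (mul_pos (hlen.pos hT).1 (hlen.pos hT).2.1) hsin
    simp only [cross, hPv, hP0 hx, hP1 hx, hP0 hy, hP1 hy, PiLp.zero_apply]
    linarith
  have hcross' : ∀ {x y}, {v, x, y} ∈ triangles S → N y x → cross (P v) (P x) (P y) < 0 := by
    intro x y hT hxy
    have h := hcross (triangle_perm' hT) hxy
    unfold cross at h ⊢
    linarith
  refine ⟨P, fun T hT hvT x hx y hy hxy => ?_, fun w x y hxy hx hy => ?_⟩
  · by_cases hxv : x = v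
    · subst hxv
      obtain ⟨z, rfl⟩ := exists_third_vertex hT hx hy hxy
      exact hvdist hT
    by_cases hyv : y = v
    · subst hyv
      obtain ⟨z, rfl⟩ := exists_third_vertex hT hy hx hxy.symm
      rw [dist_comm, Finset.pair_comm]
      exact hvdist hT
    obtain ⟨z, rfl⟩ := exists_third_vertex hT hvT hx (Ne.symm hxv)
    simp only [Finset.mem_insert, Finset.mem_singleton] at hy
    obtain rfl : y = z := by tauto
    exact hxdist hT
  · have hne : P v ≠ P w := by
      rw [← dist_ne_zero, hvdist hx]
      exact (hlen.pos hx).1.ne'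
    rw [sOppSide_line_iff hne]
    -- Successors and predecessors under `N` are unique, so one of `x`, `y` follows `w` and the
    -- other precedes it; the two signed areas have opposite signs.
    rcases hN w x (hadj.2 hx) with h1 | h1 <;> rcases hN w y (hadj.2 hy) with h2 | h2
    · exact absurd (hNr _ _ _ h1 h2) hxy
    · exact mul_neg_of_pos_of_neg (hcross hx h1) (hcross' hy h2)
    · exact mul_neg_of_neg_of_pos (hcross' hx h1) (hcross hy h2)
    · exact absurd (hNl _ _ _ h1 h2) hxy

end Star

/-! ### M-weighted points of a placement -/

/-- In light-cone coordinates put `s = ξ 3 - ξ 2` and `r = ξ 3 + ξ 2`. With `s v = exp (-f v)` the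
point `p v` fixes the first two coordinates, and the norm `α v` forces `r v`. Then the product of
two such points is half of `α v * exp (f v) * s w + α w * exp (f w) * s v - s v * s w * dist (p v)
(p w) ^ 2`, which the length formula turns into `-η {v, w}`. -/
theorem exists_mWeighted_points {V : Type*} [DecidableEq V] {S : AbstractSimplicialComplex V}
    {α : V → ℝ} {η : Finset V → ℝ} {f : V → ℝ} (hf : ∀ e ∈ edges S, 0 < edgeSq α η f e)
    {p : V → Plane} (hp : RealizesLengths S (edgeLength α η f) p) :
    ∃ ξ : V → Fin 4 → ℝ, (∀ v, ξ v ∈ MWeighted) ∧ (∀ v, mPoint (ξ v) = p v) ∧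
      (∀ v, minkowski (ξ v) (ξ v) = α v) ∧
      (∀ v w, {v, w} ∈ edges S → minkowski (ξ v) (ξ w) = -η {v, w}) := by
  let s : V → ℝ := fun v => Real.exp (-f v)
  let r : V → ℝ := fun v => s v * (p v 0 ^ 2 + p v 1 ^ 2) - α v * Real.exp (f v)
  have hs : ∀ v, 0 < s v := fun v => Real.exp_pos _
  have hsf : ∀ v, s v * Real.exp (f v) = 1 := fun v => by
    rw [← Real.exp_add]
    simp
  refine ⟨fun v => ![s v * p v 0, s v * p v 1, (r v - s v) / 2, (r v + s v) / 2], ?_, ?_, ?_, ?_⟩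
  · intro v
    change (r v - s v) / 2 < (r v + s v) / 2
    linarith [hs v]
  · intro v
    have h : (r v + s v) / 2 - (r v - s v) / 2 = s v := by ring
    refine plane_ext ?_ ?_
    · change s v * p v 0 / ((r v + s v) / 2 - (r v - s v) / 2) = p v 0
      rw [h, mul_div_cancel_left₀ _ (hs v).ne']
    · change s v * p v 1 / ((r v + s v) / 2 - (r v - s v) / 2) = p v 1
      rw [h, mul_div_cancel_left₀ _ (hs v).ne']
  · intro v
    change s v * p v 0 * (s v * p v 0) + s v * p v 1 * (s v * p v 1)
      + (r v - s v) / 2 * ((r v - s v) / 2) - (r v + s v) / 2 * ((r v + s v) / 2) = α v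
    simp only [r]
    linear_combination α v * hsf v
  · intro v w hvw
    have hd : dist (p v) (p w) ^ 2 = edgeSq α η f {v, w} := by
      rw [← hp v w hvw, edgeLength, Real.sq_sqrt (hf _ hvw).le]
    rw [edgeSq_pair α η f (ne_of_mem_edges hvw), dist_sq_plane, two_mul (f v), two_mul (f w),
      Real.exp_add, Real.exp_add, Real.exp_add] at hd
    have hv := hsf v
    have hw := hsf w
    change s v * p v 0 * (s w * p w 0) + s v * p v 1 * (s w * p w 1)
      + (r v - s v) / 2 * ((r w - s w) / 2) - (r v + s v) / 2 * ((r w + s w) / 2) = -η {v, w}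
    simp only [r]
    generalize Real.exp (f v) = x at *
    generalize Real.exp (f w) = y at *
    linear_combination (-(s v * s w) / 2) * hd + (-(α v * s w * x) / 2) * hv
      + (-(α w * s v * y) / 2) * hw - η {v, w} * (s w * y * hv + hw)

end DiscreteConformal

end

theorem mainTheorem3 {V : Type*} [Fintype V] [DecidableEq V]
    (S : AbstractSimplicialComplex V) (hS : DiscreteConformal.IsCombinatorialClosedDisk S)
    (α : V → ℝ) (η : Finset V → ℝ) (f : V → ℝ)
    (hf : DiscreteConformal.IsLabel S α η f)
    (hK : ∀ v, DiscreteConformal.IsInteriorVertex S v →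
      DiscreteConformal.curvature S α η f v = 0) :
    (∃ p : V → DiscreteConformal.Plane,
      DiscreteConformal.RealizesLengths S (DiscreteConformal.edgeLength α η f) p ∧
        DiscreteConformal.IsUnfolded S p) ∧
    (∀ p q : V → DiscreteConformal.Plane,
      DiscreteConformal.RealizesLengths S (DiscreteConformal.edgeLength α η f) p →
      DiscreteConformal.IsUnfolded S p →
      DiscreteConformal.RealizesLengths S (DiscreteConformal.edgeLength α η f) q →
      DiscreteConformal.IsUnfolded S q →
      ∃ g : DiscreteConformal.Plane ≃ᵢ DiscreteConformal.Plane, ∀ v, q v = g (p v)) ∧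
    (∀ p : V → DiscreteConformal.Plane,
      DiscreteConformal.RealizesLengths S (DiscreteConformal.edgeLength α η f) p →
      ∃ ξ : V → Fin 4 → ℝ,
        (∀ v, ξ v ∈ DiscreteConformal.MWeighted) ∧
        (∀ v, DiscreteConformal.mPoint (ξ v) = p v) ∧
        (∀ v, DiscreteConformal.minkowski (ξ v) (ξ v) = α v) ∧
        (∀ v w, {v, w} ∈ DiscreteConformal.edges S →
          DiscreteConformal.minkowski (ξ v) (ξ w) = -η {v, w})) := by
  have hlen : DiscreteConformal.TriangleLT S (DiscreteConformal.edgeLength α η f) := hf.triangle_lt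
  refine ⟨DiscreteConformal.exists_placement_of_star_placements hS hlen fun v =>
    DiscreteConformal.exists_isStarPlacement hS hlen v fun hv => (sub_eq_zero.1 (hK v hv)).symm,
    fun p q hp hp' hq hq' =>
      DiscreteConformal.exists_isometryEquiv_of_isUnfolded hS hlen hp hp' hq hq',
    fun p hp => DiscreteConformal.exists_mWeighted_points hf.edgeSq_pos hp⟩
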